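/- Let $d\ge 1$, $m\ge 1$ and $1<p_1,\dots,p_m,p<\infty$ with $\frac1p=\sum_{i=1}^m\frac1{p_i}$. For $\vec f=(f_1,\dots,f_m)$ with each $f_i:\mathbb R^d\to\mathbb R$ locally integrable, let $$\mathscr M_{\mathcal R}(\vec f)(x)=\sup_{R\in\mathcal R,\ R\ni x}\ \prod_{i=1}^m\frac1{|R|}\int_R|f_i(y)|\,dy\in[0,\infty],\qquad x\in\mathbb R^d,$$ where $\mathcal R$ is the family of all bounded open rectangles in $\mathbb R^d$ with sides parallel to the coordinate axes. For $1<q<\infty$, let $W^{1,q}(\mathbb R^d)$ be the Sobolev space of those $f\in L^q(\mathbb R^d)$ whose weak partial derivatives $D_1f,\dots,D_df$ exist and lie in $L^q(\mathbb R^d)$, with norm $\|f\|_{1,q}=\|f\|_{L^q}+\|\nabla f\|_{L^q}$, where $\nabla f=(D_1f,\dots,D_df)$. Then the following hold. 1. (Boundedness) There is a constant $C$, depending only on $m,d,p_1,\dots,p_m$, such that whenever $f_i\in W^{1,p_i}(\mathbb R^d)$ for $1\le i\le m$, the function $\mathscr M_{\mathcal R}(\vec f)$ is finite almost everywhere, belongs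 to $W^{1,p}(\mathbb R^d)$, and $$\|\mathscr M_{\mathcal R}(\vec f)\|_{1,p}\le C\prod_{i=1}^m\|f_i\|_{1,p_i}.$$ 2. (Continuity) The map $\vec f\mapsto\mathscr M_{\mathcal R}(\vec f)$ is continuous from $W^{1,p_1}(\mathbb R^d)\times\cdots\times W^{1,p_m}(\mathbb R^d)$ to $W^{1,p}(\mathbb R^d)$. 3. (Pointwise estimate) There is a constant $C$, depending only on $m,d,p_1,\dots,p_m$, such that whenever $f_i\in W^{1,p_i}(\mathbb R^d)$ for $1\le i\le m$, one has for every $1\le l\le d$ $$|D_l\mathscr M_{\mathcal R}(\vec f)(x)|\le C\sum_{\mu=1}^m\mathscr M_{\mathcal R}(f_1,\dots,f_{\mu-1},D_lf_\mu,f_{\mu+1},\dots,f_m)(x)\quad\text{for almost every }x\in\mathbb R^d.$$ -/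

import Mathlib

open MeasureTheory
open scoped ENNReal NNReal ContDiff

noncomputable section

/-- The open rectangle `(a₁, b₁) × ⋯ × (a_d, b_d)` with sides parallel to the axes. -/
def openRectangle {d : ℕ} (a b : EuclideanSpace ℝ (Fin d)) : Set (EuclideanSpace ℝ (Fin d)) :=
  {y | ∀ k, a k < y k ∧ y k < b k}

/-- The multilinear strong maximal function of `f = (f₁, …, f_m)`, with values in `[0, ∞]`: at `x`,
the supremum over all open axis-parallel rectangles `R` containing `x` of
`∏ i, |R|⁻¹ ∫_R |f i|`. -/
def strongMaximal {d m : ℕ} (f : Fin m → EuclideanSpace ℝ (Fin d) → ℝ)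
    (x : EuclideanSpace ℝ (Fin d)) : ℝ≥0∞ :=
  ⨆ (a : EuclideanSpace ℝ (Fin d)) (b : EuclideanSpace ℝ (Fin d)) (_ : x ∈ openRectangle a b),
    ∏ i, (volume (openRectangle a b))⁻¹ * ∫⁻ y in openRectangle a b, ‖f i y‖ₑ

/-- The multilinear strong maximal function as a real-valued function; it is the function
`strongMaximal f` wherever the latter is finite. -/
def strongMaximalReal {d m : ℕ} (f : Fin m → EuclideanSpace ℝ (Fin d) → ℝ)
    (x : EuclideanSpace ℝ (Fin d)) : ℝ :=
  (strongMaximal f x).toReal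

/-- `g` is a weak `l`-th partial derivative of `f` on `ℝ^d`. -/
def HasWeakPartial {d : ℕ} (l : Fin d) (f g : EuclideanSpace ℝ (Fin d) → ℝ) : Prop :=
  LocallyIntegrable f ∧ LocallyIntegrable g ∧
    ∀ φ : EuclideanSpace ℝ (Fin d) → ℝ, ContDiff ℝ ∞ φ → HasCompactSupport φ →
      ∫ x, f x * fderiv ℝ φ x (EuclideanSpace.single l 1) = -∫ x, g x * φ x

/-- Weak partial derivatives are unique up to a null set. -/
theorem HasWeakPartial.ae_eq {d : ℕ} {l : Fin d} {f g h : EuclideanSpace ℝ (Fin d) → ℝ}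
    (hg : HasWeakPartial l f g) (hh : HasWeakPartial l f h) : g =ᵐ[volume] h := by
  refine ae_eq_of_integral_contDiff_smul_eq hg.2.1 hh.2.1 fun φ hφ hc => ?_
  have := (hg.2.2 φ hφ hc).symm.trans (hh.2.2 φ hφ hc)
  simpa [mul_comm] using this

open scoped Classical in
/-- The weak partial derivative `D_l f` (a representative of it; `0` if there is none). -/
def weakPartial {d : ℕ} (l : Fin d) (f : EuclideanSpace ℝ (Fin d) → ℝ) :
    EuclideanSpace ℝ (Fin d) → ℝ :=
  if h : ∃ g, HasWeakPartial l f g then h.choose else 0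

theorem HasWeakPartial.weakPartial {d : ℕ} {l : Fin d} {f g : EuclideanSpace ℝ (Fin d) → ℝ}
    (hg : HasWeakPartial l f g) : HasWeakPartial l f (weakPartial l f) := by
  have h : ∃ g, HasWeakPartial l f g := ⟨g, hg⟩
  rw [_root_.weakPartial, dif_pos h]
  exact h.choose_spec

/-- The weak gradient `∇f = (D_1 f, …, D_d f)`. -/
def weakGradient {d : ℕ} (f : EuclideanSpace ℝ (Fin d) → ℝ) (x : EuclideanSpace ℝ (Fin d)) :
    EuclideanSpace ℝ (Fin d) :=
  WithLp.toLp 2 fun l => weakPartial l f x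

/-- `f ∈ W^{1,p}(ℝ^d)`: `f` lies in `L^p(ℝ^d)`, and its weak partial derivatives exist and lie in `L^p(ℝ^d)`. -/
def MemW1 {d : ℕ} (p : ℝ≥0∞) (f : EuclideanSpace ℝ (Fin d) → ℝ) : Prop :=
  MemLp f p volume ∧ ∀ l, ∃ g, HasWeakPartial l f g ∧ MemLp g p volume

/-- The norm `‖f‖_{1,p} = ‖f‖_{L^p} + ‖∇f‖_{L^p}` of `f ∈ W^{1,p}(ℝ^d)`, with the Euclidean length
of the gradient. -/
def w1Norm {d : ℕ} (p : ℝ≥0∞) (f : EuclideanSpace ℝ (Fin d) → ℝ) : ℝ≥0∞ :=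
  eLpNorm f p volume + eLpNorm (weakGradient f) p volume

end

/-! The supremum is turned into a norm. For fixed `x`, the averages of `f i` around `x` against the
`i`-th kernel of a `KernelTuple` form a bounded function `averageMap i (f i) x` of the tuple. A
kernel may carry the sign of `f i`, so absolute values become superfluous: wherever the maximal
functions of the single `f i` are finite, `strongMaximalReal f x` is the sup norm of `∏ i,
averageMap i (f i) x` (`strongMaximalReal_eq_norm`). The maximal operator is thus a norm applied to
a product of vector-valued averages that are linear in `f i`.

Let `g i` be the weak derivative of `f i` in direction `l`. Kernel averages obey the fundamental
theorem of calculus along every line parallel to the `l`-th axis. From this, `averageMap i (f i)`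
restricted to the line through almost every `x` has derivative `averageMap i (g i) x` there, in the
sup norm (`hasDerivAt_averageMap`). For continuous compactly supported `g i`, uniform continuity
makes the remainder small uniformly in the kernels; the general case follows by density and the
`L^q` bounds for `rectMax` and `lineMax`, which come from the one-dimensional Hardy–Littlewood
inequality, iterated over the coordinates for `rectMax`. The product rule then gives a curve `a + t
b + o(t)` with `a = productMap f x` and `b = productMapDeriv f g x`.

Since `t ↦ ‖a + t b‖` is convex, the maximal function has both one-sided derivatives along the line.
The difference quotients are dominated, so each one-sided derivative is a weak derivative; by
uniqueness they agree almost everywhere. Hence `D_l` of the maximal function is, at almost every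
`x`, the two-sided derivative of `‖a + t b‖` at `0` (`exists_hasWeakPartial_strongMaximalReal`). It
is at most `‖b‖` in absolute value, which gives the pointwise estimate with constant `1`; Hölder's
inequality then gives boundedness.

The same description yields continuity. Along a rapidly converging sequence of data, `a` and `b`
converge at almost every `x`, so the convex functions `‖a + t b‖` converge pointwise and their
derivatives at `0` converge too (`tendsto_deriv_of_convexOn`). A majorant in `L^p` upgrades this to
convergence in norm. -/

section StrongMaximalFunction

open Set Filter Topology
open scoped BoundedContinuousFunction

/-! ### The Hardy–Littlewood maximal inequality on the line -/

/-- The uncentred Hardy–Littlewood maximal function on the line, over intervals with rational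
endpoints. -/
noncomputable def intervalMax (f : ℝ → ℝ≥0∞) (x : ℝ) : ℝ≥0∞ :=
  ⨆ (p : ℚ) (q : ℚ), (Ioo (p : ℝ) q).indicator
    (fun _ => (ENNReal.ofReal (q - p))⁻¹ * ∫⁻ t in Icc (p : ℝ) q, f t) x

theorem lt_intervalMax_iff {f : ℝ → ℝ≥0∞} {x : ℝ} {c : ℝ≥0∞} :
    c < intervalMax f x ↔ ∃ p q : ℚ, x ∈ Ioo (p : ℝ) q ∧
      c < (ENNReal.ofReal (q - p))⁻¹ * ∫⁻ t in Icc (p : ℝ) q, f t := by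
  simp only [intervalMax, lt_iSup_iff]
  refine exists_congr fun p => exists_congr fun q => ?_
  by_cases h : x ∈ Ioo (p : ℝ) q <;> simp [h]

theorem measurable_intervalMax (f : ℝ → ℝ≥0∞) : Measurable (intervalMax f) :=
  Measurable.iSup fun _ => Measurable.iSup fun _ => measurable_const.indicator measurableSet_Ioo

theorem intervalMax_add_const_le (f : ℝ → ℝ≥0∞) (c : ℝ≥0∞) (x : ℝ) :
    intervalMax (fun t => f t + c) x ≤ intervalMax f x + c := by
  refine iSup_le fun p => iSup_le fun q => ?_
  by_cases h : x ∈ Ioo (p : ℝ) q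
  · have hpq : (0 : ℝ) < q - p := sub_pos.2 (h.1.trans h.2)
    have h1 : (ENNReal.ofReal ((q : ℝ) - p))⁻¹ * ∫⁻ t in Icc (p : ℝ) q, f t ≤ intervalMax f x := by
      refine le_trans (le_of_eq ?_) (le_iSup_of_le p (le_iSup_of_le q le_rfl))
      rw [indicator_of_mem h]
    rw [indicator_of_mem h, lintegral_add_right _ measurable_const, mul_add]
    gcongr
    rw [setLIntegral_const, Real.volume_Icc, mul_comm c, ← mul_assoc,
      ENNReal.inv_mul_cancel (by simpa using hpq) ENNReal.ofReal_ne_top, one_mul]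
  · rw [indicator_of_notMem h]
    exact zero_le

theorem intervalMax_mono {f g : ℝ → ℝ≥0∞} (h : ∀ t, f t ≤ g t) (x : ℝ) :
    intervalMax f x ≤ intervalMax g x := by
  refine iSup_mono fun p => iSup_mono fun q => indicator_le_indicator ?_
  gcongr with t
  exact h t

/-- The weak type `(1, 1)` inequality. -/
theorem mul_volume_intervalMax_le (f : ℝ → ℝ≥0∞) {c : ℝ≥0∞} (hc : c ≠ 0) (hc' : c ≠ ⊤) :
    c * volume {x | c < intervalMax f x} ≤ 4 * ∫⁻ t, f t := by
  by_cases hI : ∫⁻ t, f t = ⊤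
  · simp [hI]
  -- Closed intervals on which `f` has average at least `c`, coded as balls for Vitali's covering
  -- lemma. Their lengths are at most `(∫ f) / c`, and rational endpoints make every subfamily
  -- countable. The enlargement factor `4` becomes the constant of the inequality.
  set T : Set (ℚ × ℚ) := {a | (a.1 : ℝ) < a.2 ∧
    c * ENNReal.ofReal ((a.2 : ℝ) - a.1) ≤ ∫⁻ t in Icc (a.1 : ℝ) a.2, f t} with hT
  have hIcc (a : ℚ × ℚ) (τ : ℝ) :
      volume (Metric.closedBall (((a.1 : ℝ) + a.2) / 2) (τ * (((a.2 : ℝ) - a.1) / 2)))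
        = ENNReal.ofReal (τ * ((a.2 : ℝ) - a.1)) := by
    rw [Real.volume_closedBall]; congr 1; ring
  have hIcc' (a : ℚ × ℚ) :
      Metric.closedBall (((a.1 : ℝ) + a.2) / 2) (((a.2 : ℝ) - a.1) / 2) = Icc (a.1 : ℝ) a.2 := by
    rw [Real.closedBall_eq_Icc]; congr 1 <;> ring
  obtain ⟨u, huT, hdisj, hcov⟩ := Vitali.exists_disjoint_subfamily_covering_enlargement_closedBall
    T (fun a => ((a.1 : ℝ) + a.2) / 2) (fun a => ((a.2 : ℝ) - a.1) / 2)
    (((∫⁻ t, f t) / c).toReal) (by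
      intro a ha
      have h1 : ENNReal.ofReal ((a.2 : ℝ) - a.1) ≤ (∫⁻ t, f t) / c := by
        rw [ENNReal.le_div_iff_mul_le (Or.inl hc) (Or.inl hc'), mul_comm]
        exact ha.2.trans (setLIntegral_le_lintegral _ _)
      have h2 := ENNReal.toReal_mono (ENNReal.div_ne_top hI hc) h1
      rw [ENNReal.toReal_ofReal (by linarith [ha.1])] at h2
      linarith [ha.1]) 4 (by norm_num)
  have hsub : {x | c < intervalMax f x} ⊆ ⋃ a ∈ u,
      Metric.closedBall (((a.1 : ℝ) + a.2) / 2) (4 * (((a.2 : ℝ) - a.1) / 2)) := by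
    intro x hx
    obtain ⟨p, q, hxpq, hlt⟩ := lt_intervalMax_iff.1 hx
    have hpq : (0 : ℝ) < q - p := sub_pos.2 (hxpq.1.trans hxpq.2)
    have hmem : (p, q) ∈ T := by
      refine ⟨by linarith, ?_⟩
      have := hlt.le
      rw [mul_comm, ← div_eq_mul_inv, ENNReal.le_div_iff_mul_le
        (Or.inl (by simpa using hpq)) (Or.inl ENNReal.ofReal_ne_top)] at this
      exact this
    obtain ⟨b, hb, hsub⟩ := hcov _ hmem
    refine mem_iUnion₂.2 ⟨b, hb, hsub ?_⟩
    rw [hIcc']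
    exact Ioo_subset_Icc_self hxpq
  calc c * volume {x | c < intervalMax f x}
      ≤ c * ∑' a : u, ENNReal.ofReal (4 * ((a.1.2 : ℝ) - a.1.1)) := by
        gcongr
        refine (measure_mono hsub).trans ((measure_biUnion_le _ u.to_countable _).trans ?_)
        simp_rw [hIcc]; rfl
    _ ≤ ∑' a : u, 4 * ∫⁻ t in Icc (a.1.1 : ℝ) a.1.2, f t := by
        rw [← ENNReal.tsum_mul_left]
        refine ENNReal.tsum_le_tsum fun a => ?_
        rw [ENNReal.ofReal_mul (by norm_num), mul_left_comm]
        have := (huT a.2).2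
        simpa using mul_le_mul_right this (4 : ℝ≥0∞)
    _ = 4 * ∫⁻ t in ⋃ a ∈ u, Icc (a.1 : ℝ) a.2, f t := by
        rw [ENNReal.tsum_mul_left, lintegral_biUnion u.to_countable (fun _ _ => measurableSet_Icc)]
        intro a ha b hb hab
        simpa only [Function.onFun, hIcc'] using hdisj ha hb hab
    _ ≤ 4 * ∫⁻ t, f t := by
        gcongr
        exact Measure.restrict_le_self

/-- The layer-cake formula for a single value; `u = ⊤` must be allowed because maximal functions are
not yet known to be finite. -/
theorem lintegral_Ioi_rpow_of_lt {s : ℝ} (hs : 0 < s) (u : ℝ≥0∞) :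
    ∫⁻ r in Ioi (0 : ℝ), {r : ℝ | ENNReal.ofReal r < u}.indicator
      (fun r => ENNReal.ofReal (r ^ (s - 1))) r = ENNReal.ofReal s⁻¹ * u ^ s := by
  have key (v : ℝ) (hv : 0 ≤ v) : ∫⁻ r in Ioi (0 : ℝ), {r : ℝ | r < v}.indicator
      (fun r => ENNReal.ofReal (r ^ (s - 1))) r = ENNReal.ofReal s⁻¹ * ENNReal.ofReal v ^ s := by
    have : ∫ r in (0 : ℝ)..v, r ^ (s - 1) = s⁻¹ * v ^ s := by
      rw [integral_rpow (Or.inl (by linarith))]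
      simp [hs.ne', div_eq_inv_mul]
    rw [ENNReal.ofReal_rpow_of_nonneg hv hs.le, ← ENNReal.ofReal_mul (by positivity), ← this,
      intervalIntegral.integral_of_le hv, ofReal_integral_eq_lintegral_ofReal,
      setLIntegral_indicator (show MeasurableSet {r : ℝ | r < v} from measurableSet_Iio)]
    · rw [show {r : ℝ | r < v} ∩ Ioi 0 = Ioo 0 v by ext; simp [and_comm], restrict_Ioo_eq_restrict_Ioc]
    · have := intervalIntegral.intervalIntegrable_rpow' (a := 0) (b := v) (r := s - 1) (by linarith)
      exact (intervalIntegrable_iff_integrableOn_Ioc_of_le hv).1 this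
    · filter_upwards [ae_restrict_mem measurableSet_Ioc] with r hr
      exact Real.rpow_nonneg hr.1.le _
  by_cases hu : u = ⊤
  · subst hu
    rw [ENNReal.top_rpow_of_pos hs, ENNReal.mul_top (by simpa using hs)]
    -- Cutting the integral off at `(s * N) ^ s⁻¹` gives exactly `N`.
    refine ENNReal.eq_top_of_forall_nnreal_le fun N => ?_
    have h1 := key ((s * N) ^ (s⁻¹)) (by positivity)
    rw [ENNReal.ofReal_rpow_of_nonneg (by positivity) hs.le, ← Real.rpow_mul (by positivity),
      inv_mul_cancel₀ hs.ne', Real.rpow_one, ← ENNReal.ofReal_mul (by positivity),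
      inv_mul_cancel_left₀ hs.ne', ENNReal.ofReal_coe_nnreal] at h1
    rw [← h1]
    refine lintegral_mono fun r => indicator_le_indicator_of_subset (fun r _ => ?_)
      (fun _ => zero_le) r
    exact ENNReal.ofReal_lt_top
  · have h1 := key u.toReal ENNReal.toReal_nonneg
    rw [ENNReal.ofReal_toReal hu] at h1
    rw [← h1]
    refine setLIntegral_congr_fun measurableSet_Ioi fun r hr => ?_
    have : ENNReal.ofReal r < u ↔ r < u.toReal :=
      ENNReal.ofReal_lt_iff_lt_toReal (le_of_lt hr) hu
    simp only [indicator, mem_ofPred_eq, this]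

/-- The strong type `(q, q)` inequality. -/
theorem lintegral_intervalMax_rpow_le {f : ℝ → ℝ≥0∞} (hf : Measurable f) {q : ℝ} (hq : 1 < q) :
    ∫⁻ t, intervalMax f t ^ q ≤
      ENNReal.ofReal (q * 8 * (q - 1)⁻¹ * 2 ^ (q - 1)) * ∫⁻ t, f t ^ q := by
  have hq0 : 0 < q := by linarith
  have hq1 : 0 < q - 1 := by linarith
  have hofReal : Measurable fun a : ℝ × ℝ => ENNReal.ofReal a.1 := by fun_prop
  have layer (u : ℝ≥0∞) : u ^ q = ENNReal.ofReal q * ∫⁻ r in Ioi (0 : ℝ),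
      {r : ℝ | ENNReal.ofReal r < u}.indicator (fun r => ENNReal.ofReal (r ^ (q - 1))) r := by
    rw [lintegral_Ioi_rpow_of_lt hq0, ← mul_assoc, ← ENNReal.ofReal_mul hq0.le,
      mul_inv_cancel₀ hq0.ne', ENNReal.ofReal_one, one_mul]
  -- The part of `f` that is at most `r / 2` contributes at most `r / 2` to the maximal function, so
  -- the rest must exceed `r / 2` there. The weak inequality at level `r / 2` turns its constant `4`
  -- into `8`.
  have weak (r : ℝ) (hr : 0 < r) : volume {t | ENNReal.ofReal r < intervalMax f t} ≤
      8 * (ENNReal.ofReal r)⁻¹ * ∫⁻ t, {t | ENNReal.ofReal r < 2 * f t}.indicator f t := by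
    have hr2 : ENNReal.ofReal (r / 2) ≠ 0 := by simpa using hr
    have hcut (t : ℝ) : f t ≤ {t | ENNReal.ofReal r < 2 * f t}.indicator f t
        + ENNReal.ofReal (r / 2) := by
      by_cases h : ENNReal.ofReal r < 2 * f t
      · rw [indicator_of_mem (by exact h)]; exact le_self_add
      · rw [indicator_of_notMem (by exact h), zero_add, ENNReal.ofReal_div_of_pos two_pos,
          ENNReal.le_div_iff_mul_le (by simp) (by simp), mul_comm]
        simpa using h
    have h1 : {t | ENNReal.ofReal r < intervalMax f t} ⊆ {t | ENNReal.ofReal (r / 2) <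
        intervalMax ({t | ENNReal.ofReal r < 2 * f t}.indicator f) t} := by
      intro t ht
      have h2 := (intervalMax_mono hcut t).trans (intervalMax_add_const_le _ _ t)
      have h3 : ENNReal.ofReal r = ENNReal.ofReal (r / 2) + ENNReal.ofReal (r / 2) := by
        rw [← ENNReal.ofReal_add (by linarith) (by linarith), add_halves]
      have h4 := lt_of_lt_of_le (by exact ht) h2
      exact lt_of_add_lt_add_right (h3.symm.trans_lt h4)
    have h5 := mul_volume_intervalMax_le ({t | ENNReal.ofReal r < 2 * f t}.indicator f) hr2
      ENNReal.ofReal_ne_top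
    refine (measure_mono h1).trans ?_
    rw [mul_comm, ← ENNReal.le_div_iff_mul_le (Or.inl hr2) (Or.inl ENNReal.ofReal_ne_top)] at h5
    refine h5.trans (le_of_eq ?_)
    rw [ENNReal.ofReal_div_of_pos two_pos, div_eq_mul_inv, ENNReal.inv_div (by simp) (by simp),
      ENNReal.ofReal_ofNat, div_eq_mul_inv]
    ring
  have hmeas : Measurable fun a : ℝ × ℝ => {r : ℝ | ENNReal.ofReal r < intervalMax f a.2}.indicator
      (fun r => ENNReal.ofReal (r ^ (q - 1))) a.1 := by
    have h1 : MeasurableSet {a : ℝ × ℝ | ENNReal.ofReal a.1 < intervalMax f a.2} :=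
      measurableSet_lt hofReal ((measurable_intervalMax f).comp measurable_snd)
    have h2 : Measurable fun a : ℝ × ℝ => ENNReal.ofReal (a.1 ^ (q - 1)) := by fun_prop
    exact h2.indicator h1
  have hmeas' : Measurable fun a : ℝ × ℝ => {r : ℝ | ENNReal.ofReal r < 2 * f a.2}.indicator
      (fun r => ENNReal.ofReal (r ^ (q - 1 - 1)) * f a.2) a.1 := by
    have h1 : MeasurableSet {a : ℝ × ℝ | ENNReal.ofReal a.1 < 2 * f a.2} :=
      measurableSet_lt hofReal ((hf.comp measurable_snd).const_mul 2)
    have h2 : Measurable fun a : ℝ × ℝ => ENNReal.ofReal (a.1 ^ (q - 1 - 1)) * f a.2 := by fun_prop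
    exact h2.indicator h1
  simp_rw [layer (intervalMax f _)]
  rw [lintegral_const_mul' _ _ ENNReal.ofReal_ne_top, lintegral_lintegral_swap
    (f := fun t r => {r : ℝ | ENNReal.ofReal r < intervalMax f t}.indicator
      (fun r => ENNReal.ofReal (r ^ (q - 1))) r) (hmeas.comp measurable_swap).aemeasurable]
  calc ENNReal.ofReal q * ∫⁻ r in Ioi (0 : ℝ), ∫⁻ t,
        {r : ℝ | ENNReal.ofReal r < intervalMax f t}.indicator
          (fun r => ENNReal.ofReal (r ^ (q - 1))) r
      ≤ ENNReal.ofReal q * ∫⁻ r in Ioi (0 : ℝ), 8 * ∫⁻ t,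
        {r : ℝ | ENNReal.ofReal r < 2 * f t}.indicator
          (fun r => ENNReal.ofReal (r ^ (q - 1 - 1)) * f t) r := by
        refine mul_le_mul_right (setLIntegral_mono' measurableSet_Ioi fun r (hr : 0 < r) => ?_) _
        have e1 : ∫⁻ t, {r : ℝ | ENNReal.ofReal r < intervalMax f t}.indicator
            (fun r => ENNReal.ofReal (r ^ (q - 1))) r
            = ENNReal.ofReal (r ^ (q - 1)) * volume {t | ENNReal.ofReal r < intervalMax f t} := by
          rw [← lintegral_indicator_const (measurableSet_lt measurable_const
            (measurable_intervalMax f))]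
          rfl
        have e2 : ∫⁻ t, {r : ℝ | ENNReal.ofReal r < 2 * f t}.indicator
            (fun r => ENNReal.ofReal (r ^ (q - 1 - 1)) * f t) r
            = ENNReal.ofReal (r ^ (q - 1 - 1)) *
              ∫⁻ t, {t | ENNReal.ofReal r < 2 * f t}.indicator f t := by
          rw [← lintegral_const_mul' _ _ ENNReal.ofReal_ne_top]
          refine lintegral_congr fun t => ?_
          by_cases h : ENNReal.ofReal r < 2 * f t <;> simp [indicator, h]
        rw [e1, e2]
        refine (mul_le_mul_right (weak r hr) _).trans (le_of_eq ?_)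
        have : ENNReal.ofReal (r ^ (q - 1)) * (ENNReal.ofReal r)⁻¹
            = ENNReal.ofReal (r ^ (q - 1 - 1)) := by
          rw [← ENNReal.ofReal_inv_of_pos hr, ← ENNReal.ofReal_mul (by positivity),
            Real.rpow_sub_one hr.ne' (q - 1), div_eq_mul_inv]
        rw [← this]
        ring
    -- After exchanging the integrals, `r` ranges over `r < 2 * f t`: the layer-cake formula with
    -- exponent `q - 1` produces the factors `(q - 1)⁻¹` and `2 ^ (q - 1)`.
    _ = ENNReal.ofReal q * (8 * ∫⁻ t, f t * (ENNReal.ofReal (q - 1)⁻¹ * (2 * f t) ^ (q - 1))) := by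
        rw [lintegral_const_mul' _ _ (by simp), lintegral_lintegral_swap hmeas'.aemeasurable]
        congr 2
        refine lintegral_congr fun t => ?_
        rw [← lintegral_Ioi_rpow_of_lt hq1, ← lintegral_const_mul _ (by
          refine Measurable.indicator (by fun_prop) (measurableSet_lt (by fun_prop) (by fun_prop)))]
        refine lintegral_congr fun r => ?_
        by_cases h : ENNReal.ofReal r < 2 * f t <;> simp [indicator, mul_comm]
    _ = _ := by
        have (t : ℝ) : f t * (ENNReal.ofReal (q - 1)⁻¹ * (2 * f t) ^ (q - 1))
            = ENNReal.ofReal ((q - 1)⁻¹ * 2 ^ (q - 1)) * f t ^ q := by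
          rw [ENNReal.mul_rpow_of_nonneg _ _ hq1.le, ENNReal.ofReal_mul (by positivity),
            ← ENNReal.ofReal_rpow_of_pos two_pos, ENNReal.ofReal_ofNat]
          have : f t ^ q = f t * f t ^ (q - 1) := by
            nth_rewrite 2 [← ENNReal.rpow_one (f t)]
            rw [← ENNReal.rpow_add_of_nonneg _ _ zero_le_one hq1.le]
            congr 1; ring
          rw [this]; ring
        simp_rw [this]
        rw [lintegral_const_mul' _ _ ENNReal.ofReal_ne_top, ← mul_assoc, ← mul_assoc,
          ← ENNReal.ofReal_ofNat 8, ← ENNReal.ofReal_mul hq0.le, ← ENNReal.ofReal_mul (by positivity)]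
        congr 2; ring

/-- Slightly larger rational intervals contain `x` in their interior, and their lengths tend to `β -
α`. Arbitrary endpoints are therefore allowed, with `x` possibly one of them. -/
theorem average_Icc_le_intervalMax (f : ℝ → ℝ≥0∞) {α β x : ℝ} (hα : α ≤ x) (hβ : x ≤ β)
    (hαβ : α < β) :
    (ENNReal.ofReal (β - α))⁻¹ * ∫⁻ t in Icc α β, f t ≤ intervalMax f x := by
  have hpos : 0 < β - α := sub_pos.2 hαβ
  have step (ε : ℝ) (hε : 0 < ε) :
      ∫⁻ t in Icc α β, f t ≤ ENNReal.ofReal (β - α + ε) * intervalMax f x := by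
    obtain ⟨p, hp1, hp2⟩ := exists_rat_btwn (show α - ε / 2 < α by linarith)
    obtain ⟨q, hq1, hq2⟩ := exists_rat_btwn (show β < β + ε / 2 by linarith)
    have h1 : (ENNReal.ofReal ((q : ℝ) - p))⁻¹ * ∫⁻ t in Icc (p : ℝ) q, f t ≤ intervalMax f x := by
      refine le_trans (le_of_eq ?_) (le_iSup_of_le p (le_iSup_of_le q le_rfl))
      rw [indicator_of_mem (mem_Ioo.2 ⟨by linarith, by linarith⟩)]
    rw [mul_comm, ← div_eq_mul_inv, ENNReal.div_le_iff_le_mul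
      (Or.inl (by simpa using show (p : ℝ) < q by linarith)) (Or.inl ENNReal.ofReal_ne_top), mul_comm] at h1
    calc ∫⁻ t in Icc α β, f t ≤ ∫⁻ t in Icc (p : ℝ) q, f t :=
          lintegral_mono_set (Icc_subset_Icc hp2.le hq1.le)
      _ ≤ _ := h1
      _ ≤ _ := by gcongr; linarith
  rw [mul_comm, ← div_eq_mul_inv, ENNReal.div_le_iff_le_mul
      (Or.inl (by simpa using hαβ)) (Or.inl ENNReal.ofReal_ne_top), mul_comm]
  by_cases htop : intervalMax f x = ⊤
  · rw [htop, ENNReal.mul_top (by simpa using hαβ)]; exact le_top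
  have hlim : Tendsto (fun ε : ℝ => ENNReal.ofReal (β - α + ε) * intervalMax f x) (𝓝[>] 0)
      (𝓝 (ENNReal.ofReal (β - α + 0) * intervalMax f x)) := by
    refine ENNReal.Tendsto.mul_const ?_ (Or.inr htop)
    exact (ENNReal.continuous_ofReal.tendsto _).comp
      ((tendsto_const_nhds.add tendsto_id).mono_left nhdsWithin_le_nhds)
  rw [add_zero] at hlim
  exact ge_of_tendsto hlim (by filter_upwards [self_mem_nhdsWithin] with ε hε using step ε hε)

/-! ### The strong maximal inequality by iteration over the coordinates -/

theorem isOpen_openRectangle {d : ℕ} (a b : EuclideanSpace ℝ (Fin d)) :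
    IsOpen (openRectangle a b) := by
  simp only [openRectangle, ofPred_forall, ofPred_and]
  refine isOpen_iInter_of_finite fun k => IsOpen.inter ?_ ?_
  · exact isOpen_lt (by fun_prop) (by fun_prop)
  · exact isOpen_lt (by fun_prop) (by fun_prop)

/-- The superlevel sets are unions of open rectangles, hence open; nothing is required of `φ`. -/
theorem measurable_iSup_openRectangle {d : ℕ}
    (φ : EuclideanSpace ℝ (Fin d) → EuclideanSpace ℝ (Fin d) → ℝ≥0∞) :
    Measurable fun x => ⨆ (a : EuclideanSpace ℝ (Fin d)) (b : EuclideanSpace ℝ (Fin d))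
      (_ : x ∈ openRectangle a b), φ a b := by
  refine measurable_of_Ioi fun c => IsOpen.measurableSet ?_
  have : (fun x => ⨆ (a : EuclideanSpace ℝ (Fin d)) (b : EuclideanSpace ℝ (Fin d))
      (_ : x ∈ openRectangle a b), φ a b) ⁻¹' Ioi c =
      ⋃ (a : EuclideanSpace ℝ (Fin d)) (b : EuclideanSpace ℝ (Fin d)) (_ : c < φ a b),
        openRectangle a b := by
    ext x
    simp only [mem_preimage, mem_Ioi, lt_iSup_iff, mem_iUnion]
    exact exists_congr fun a => exists_congr fun b => ⟨fun ⟨h, h'⟩ => ⟨h', h⟩, fun ⟨h, h'⟩ => ⟨h', h⟩⟩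
  rw [this]
  refine isOpen_iUnion fun a => isOpen_iUnion fun b => isOpen_iUnion fun _ =>
    isOpen_openRectangle a b

/-- The strong maximal function of a single `[0, ∞]`-valued function. -/
noncomputable def rectMax {d : ℕ} (f : EuclideanSpace ℝ (Fin d) → ℝ≥0∞)
    (x : EuclideanSpace ℝ (Fin d)) : ℝ≥0∞ :=
  ⨆ (a : EuclideanSpace ℝ (Fin d)) (b : EuclideanSpace ℝ (Fin d)) (_ : x ∈ openRectangle a b),
    (volume (openRectangle a b))⁻¹ * ∫⁻ y in openRectangle a b, f y

theorem measurable_rectMax {d : ℕ} (f : EuclideanSpace ℝ (Fin d) → ℝ≥0∞) :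
    Measurable (rectMax f) :=
  measurable_iSup_openRectangle _

theorem measurable_strongMaximal {d m : ℕ} (f : Fin m → EuclideanSpace ℝ (Fin d) → ℝ) :
    Measurable (strongMaximal f) :=
  measurable_iSup_openRectangle _

theorem average_le_rectMax {d : ℕ} (f : EuclideanSpace ℝ (Fin d) → ℝ≥0∞)
    {a b x : EuclideanSpace ℝ (Fin d)} (hx : x ∈ openRectangle a b) :
    (volume (openRectangle a b))⁻¹ * ∫⁻ y in openRectangle a b, f y ≤ rectMax f x :=
  le_iSup_of_le a (le_iSup_of_le b (le_iSup_of_le hx le_rfl))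

theorem rectMax_congr_ae {d : ℕ} {f g : EuclideanSpace ℝ (Fin d) → ℝ≥0∞} (h : f =ᵐ[volume] g) :
    rectMax f = rectMax g := by
  funext x
  refine iSup_congr fun a => iSup_congr fun b => iSup_congr fun _ => ?_
  rw [lintegral_congr_ae (ae_restrict_of_ae h)]

theorem strongMaximal_le_prod_rectMax {d m : ℕ} (f : Fin m → EuclideanSpace ℝ (Fin d) → ℝ)
    (x : EuclideanSpace ℝ (Fin d)) :
    strongMaximal f x ≤ ∏ i, rectMax (fun y => ‖f i y‖ₑ) x := by
  refine iSup_le fun a => iSup_le fun b => iSup_le fun hx => ?_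
  exact Finset.prod_le_prod' fun i _ => average_le_rectMax _ hx

/-- The one-dimensional maximal function in the `i`-th variable. -/
noncomputable def coordMax {d : ℕ} (i : Fin d) (f : (Fin d → ℝ) → ℝ≥0∞) (x : Fin d → ℝ) : ℝ≥0∞ :=
  intervalMax (fun t => f (Function.update x i (x i + t))) 0

/-- With the line recentred at `0`, the choice of intervals does not depend on `x`; what remains is
a countable supremum of integrals depending measurably on a parameter. -/
theorem measurable_coordMax {d : ℕ} (i : Fin d) {f : (Fin d → ℝ) → ℝ≥0∞} (hf : Measurable f) :
    Measurable (coordMax i f) := by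
  unfold coordMax intervalMax
  refine Measurable.iSup fun p => Measurable.iSup fun q => ?_
  by_cases h : (0 : ℝ) ∈ Ioo (p : ℝ) q
  · simp only [indicator_of_mem h]
    refine Measurable.const_mul (Measurable.lintegral_prod_right' (f := fun a : (Fin d → ℝ) × ℝ =>
      f (Function.update a.1 i (a.1 i + a.2))) ?_) _
    refine hf.comp (measurable_pi_iff.2 fun j => ?_)
    by_cases hj : j = i
    · subst hj; simp only [Function.update_self]; fun_prop
    · simp only [Function.update_of_ne hj]; fun_prop
  · simp only [indicator_of_notMem h]; exact measurable_const

theorem setLIntegral_Icc_comp_const_add (f : ℝ → ℝ≥0∞) (c α β : ℝ) :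
    ∫⁻ t in Icc α β, f (c + t) = ∫⁻ t in Icc (c + α) (c + β), f t := by
  have h := (measurePreserving_add_left (volume : Measure ℝ) c).setLIntegral_comp_preimage_emb
    (measurableEmbedding_addLeft c) f (Icc (c + α) (c + β))
  rw [← h]
  congr 2
  ext t; simp

theorem average_Icc_le_coordMax {d : ℕ} (i : Fin d) (f : (Fin d → ℝ) → ℝ≥0∞) (x : Fin d → ℝ)
    {α β : ℝ} (hα : α ≤ x i) (hβ : x i ≤ β) (hαβ : α < β) :
    (ENNReal.ofReal (β - α))⁻¹ * ∫⁻ t in Icc α β, f (Function.update x i t) ≤ coordMax i f x := by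
  have := average_Icc_le_intervalMax (fun t => f (Function.update x i (x i + t)))
    (α := α - x i) (β := β - x i) (x := 0) (by linarith) (by linarith) (by linarith)
  rw [setLIntegral_Icc_comp_const_add (fun t => f (Function.update x i t))] at this
  simpa [coordMax] using this

/-- Undoes the recentring. The shifted endpoints `s + p` and `s + q` need not be rational, hence the
appeal to `average_Icc_le_intervalMax`. -/
theorem coordMax_update_le {d : ℕ} (i : Fin d) (f : (Fin d → ℝ) → ℝ≥0∞) (x : Fin d → ℝ) (s : ℝ) :
    coordMax i f (Function.update x i s) ≤ intervalMax (fun t => f (Function.update x i t)) s := by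
  refine iSup_le fun p => iSup_le fun q => ?_
  by_cases h : (0 : ℝ) ∈ Ioo (p : ℝ) q
  swap
  · rw [indicator_of_notMem h]
    exact zero_le
  rw [indicator_of_mem h]
  simp only [Function.update_self, Function.update_idem]
  rw [setLIntegral_Icc_comp_const_add (fun t => f (Function.update x i t))]
  have := average_Icc_le_intervalMax (fun t => f (Function.update x i t))
    (α := s + p) (β := s + q) (x := s) (by linarith [h.1]) (by linarith [h.2])
    (by linarith [h.1, h.2])
  rwa [add_sub_add_left_eq_sub] at this

theorem lintegral_coordMax_rpow_le {d : ℕ} (i : Fin d) {f : (Fin d → ℝ) → ℝ≥0∞} (hf : Measurable f)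
    {q : ℝ} (hq : 1 < q) :
    ∫⁻ x, coordMax i f x ^ q ≤
      ENNReal.ofReal (q * 8 * (q - 1)⁻¹ * 2 ^ (q - 1)) * ∫⁻ x, f x ^ q := by
  rw [← lintegral_const_mul' _ _ ENNReal.ofReal_ne_top]
  refine lintegral_le_of_lmarginal_le {i} ((measurable_coordMax i hf).pow_const q)
    ((hf.pow_const q).const_mul _) ?_
  intro x
  simp only [lmarginal_singleton]
  rw [lintegral_const_mul' _ _ ENNReal.ofReal_ne_top]
  refine le_trans ?_ (lintegral_intervalMax_rpow_le
    (f := fun t => f (Function.update x i t)) (hf.comp (measurable_update x)) hq)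
  gcongr with s
  exact coordMax_update_le i f x s

/-- An average over a rectangle is an iterated average over its sides. If `H` dominates all averages
in the coordinates of `s`, then `coordMax i H` dominates those that also average in coordinate `i`.
Each coordinate costs one factor of the one-dimensional constant, and `H` does not depend on the
rectangle. -/
theorem exists_majorant_iterated_average {d : ℕ} {q : ℝ} (hq : 1 < q) (s : Finset (Fin d)) :
    ∀ f : (Fin d → ℝ) → ℝ≥0∞, Measurable f → ∃ H : (Fin d → ℝ) → ℝ≥0∞, Measurable H ∧
      ∫⁻ x, H x ^ q ≤
        ENNReal.ofReal (q * 8 * (q - 1)⁻¹ * 2 ^ (q - 1)) ^ s.card * ∫⁻ x, f x ^ q ∧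
      ∀ a b x : Fin d → ℝ, (∀ i, a i < x i ∧ x i < b i) →
        (∏ i ∈ s, (ENNReal.ofReal (b i - a i))⁻¹) *
          (∫⋯∫⁻_s, f ∂fun i => (volume : Measure ℝ).restrict (Ioo (a i) (b i))) x ≤ H x := by
  induction s using Finset.induction_on with
  | empty => exact fun f hf => ⟨f, hf, by simp, by simp⟩
  | insert i s hi ih =>
    intro f hf
    obtain ⟨H, hH, hHq, hle⟩ := ih f hf
    refine ⟨coordMax i H, measurable_coordMax i hH, ?_, ?_⟩
    · refine (lintegral_coordMax_rpow_le i hH hq).trans ?_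
      rw [Finset.card_insert_of_notMem hi, pow_succ', mul_assoc (ENNReal.ofReal _)]
      exact mul_le_mul_right hHq _
    · intro a b x hx
      have hfin : ∏ i ∈ s, (ENNReal.ofReal (b i - a i))⁻¹ ≠ ⊤ :=
        ENNReal.prod_ne_top fun j _ => by simpa using (hx j).1.trans (hx j).2
      rw [lmarginal_insert _ hf hi, Finset.prod_insert hi, mul_assoc,
        ← lintegral_const_mul' _ _ hfin]
      refine le_trans ?_ (average_Icc_le_coordMax i H x (hx i).1.le (hx i).2.le
        ((hx i).1.trans (hx i).2))
      rw [← restrict_Ioo_eq_restrict_Icc]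
      refine mul_le_mul_right
        (setLIntegral_mono' measurableSet_Ioo fun t ht => hle a b _ fun j => ?_) _
      by_cases hj : j = i
      · subst hj; simpa using ht
      · simpa [hj] using hx j

theorem setLIntegral_openRectangle {d : ℕ} (f : EuclideanSpace ℝ (Fin d) → ℝ≥0∞)
    (a b x : EuclideanSpace ℝ (Fin d)) :
    ∫⁻ y in openRectangle a b, f y =
      (∫⋯∫⁻_Finset.univ, (fun z => f (WithLp.toLp 2 z))
        ∂fun i => (volume : Measure ℝ).restrict (Ioo (a i) (b i))) x := by
  have h := (PiLp.volume_preserving_toLp (Fin d)).setLIntegral_comp_preimage_emb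
    (MeasurableEquiv.toLp 2 (Fin d → ℝ)).measurableEmbedding f (openRectangle a b)
  rw [← h, ← lintegral_eq_lmarginal_univ, ← Measure.restrict_pi_pi]
  congr 2
  ext z; simp [openRectangle]

theorem volume_openRectangle {d : ℕ} (a b : EuclideanSpace ℝ (Fin d)) :
    volume (openRectangle a b) = ∏ i, ENNReal.ofReal (b i - a i) := by
  have h := setLIntegral_openRectangle (fun _ => 1) a b 0
  rw [setLIntegral_const, one_mul] at h
  rw [h, ← lintegral_eq_lmarginal_univ]
  simp [Measure.pi_univ]

theorem lintegral_rectMax_rpow_le {d : ℕ} {q : ℝ} (hq : 1 < q)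
    {f : EuclideanSpace ℝ (Fin d) → ℝ≥0∞} (hf : AEMeasurable f) :
    ∫⁻ x, rectMax f x ^ q ≤
      ENNReal.ofReal (q * 8 * (q - 1)⁻¹ * 2 ^ (q - 1)) ^ d * ∫⁻ x, f x ^ q := by
  -- Both sides depend only on the almost everywhere class of `f`, so a measurable representative
  -- may be used.
  have hmk : ∫⁻ x, f x ^ q = ∫⁻ x, hf.mk f x ^ q :=
    lintegral_congr_ae (by filter_upwards [hf.ae_eq_mk] with x hx; rw [hx])
  rw [rectMax_congr_ae hf.ae_eq_mk, hmk]
  have hmeas := hf.measurable_mk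
  set g := hf.mk f
  obtain ⟨H, hH, hHq, hle⟩ := exists_majorant_iterated_average hq (Finset.univ : Finset (Fin d))
    (fun z => g (WithLp.toLp 2 z)) (hmeas.comp (by fun_prop))
  rw [← (PiLp.volume_preserving_toLp (Fin d)).lintegral_comp_emb
    (MeasurableEquiv.toLp 2 (Fin d → ℝ)).measurableEmbedding,
    ← (PiLp.volume_preserving_toLp (Fin d)).lintegral_comp_emb
    (MeasurableEquiv.toLp 2 (Fin d → ℝ)).measurableEmbedding]
  rw [Finset.card_univ, Fintype.card_fin] at hHq
  refine le_trans ?_ hHq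
  gcongr with x
  refine iSup_le fun a => iSup_le fun b => iSup_le fun hx => ?_
  refine le_trans (le_of_eq ?_) (hle a b x hx)
  rw [setLIntegral_openRectangle g a b (WithLp.toLp 2 x), volume_openRectangle,
    ENNReal.prod_inv_distrib]
  intro i _ j _ _
  exact Or.inr ENNReal.ofReal_ne_top

/-- The one-dimensional maximal function in the direction of the `l`-th axis. -/
noncomputable def lineMax {d : ℕ} (l : Fin d) (f : EuclideanSpace ℝ (Fin d) → ℝ≥0∞)
    (x : EuclideanSpace ℝ (Fin d)) : ℝ≥0∞ :=
  coordMax l (fun z => f (WithLp.toLp 2 z)) (WithLp.ofLp x)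

theorem measurable_lineMax {d : ℕ} (l : Fin d) {f : EuclideanSpace ℝ (Fin d) → ℝ≥0∞}
    (hf : Measurable f) : Measurable (lineMax l f) :=
  (measurable_coordMax l (hf.comp (by fun_prop))).comp (by fun_prop)

theorem lintegral_lineMax_rpow_le {d : ℕ} (l : Fin d) {f : EuclideanSpace ℝ (Fin d) → ℝ≥0∞}
    (hf : Measurable f) {q : ℝ} (hq : 1 < q) :
    ∫⁻ x, lineMax l f x ^ q ≤
      ENNReal.ofReal (q * 8 * (q - 1)⁻¹ * 2 ^ (q - 1)) * ∫⁻ x, f x ^ q := by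
  rw [← (PiLp.volume_preserving_toLp (Fin d)).lintegral_comp_emb
    (MeasurableEquiv.toLp 2 (Fin d → ℝ)).measurableEmbedding,
    ← (PiLp.volume_preserving_toLp (Fin d)).lintegral_comp_emb
    (MeasurableEquiv.toLp 2 (Fin d → ℝ)).measurableEmbedding]
  exact lintegral_coordMax_rpow_le l (f := fun z => f (WithLp.toLp 2 z))
    (hf.comp (by fun_prop)) hq

/-- Source of all Lipschitz bounds along a line: the integral over a segment starting at `x` is its
length times an average controlled at `x`. -/
theorem lintegral_uIcc_le_lineMax {d : ℕ} (l : Fin d) (f : EuclideanSpace ℝ (Fin d) → ℝ≥0∞)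
    (x : EuclideanSpace ℝ (Fin d)) (t : ℝ) :
    ∫⁻ s in uIcc 0 t, f (x + s • EuclideanSpace.single l 1) ≤
      ENNReal.ofReal |t| * lineMax l f x := by
  rcases eq_or_ne t 0 with rfl | ht
  · simp
  have h := average_Icc_le_coordMax l (fun z => f (WithLp.toLp 2 z)) (WithLp.ofLp x)
    (α := x l + min 0 t) (β := x l + max 0 t) (by simp) (by simp)
    (by rcases lt_or_gt_of_ne ht with h | h <;> simp [h.le, h])
  rw [← setLIntegral_Icc_comp_const_add
      (fun s => f (WithLp.toLp 2 (Function.update (WithLp.ofLp x) l s))),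
    add_sub_add_left_eq_sub, max_sub_min_eq_abs, sub_zero, mul_comm, ← div_eq_mul_inv, ENNReal.div_le_iff_le_mul
    (Or.inl (by simpa using ht)) (Or.inl ENNReal.ofReal_ne_top), mul_comm] at h
  refine le_trans (le_of_eq ?_) h
  rw [uIcc]
  refine lintegral_congr fun s => ?_
  congr 1
  ext j
  by_cases hj : j = l
  · subst hj; simp
  · simp [hj]

/-! ### Weak derivatives and translations -/

section Translation

variable {d : ℕ}

/-- Makes `g (z + s • v)` jointly measurable up to null sets although `g` is only almost everywhere
measurable, as Fubini's theorem requires. -/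
theorem quasiMeasurePreserving_add_smul (v : EuclideanSpace ℝ (Fin d)) (a b : ℝ) :
    Measure.QuasiMeasurePreserving
      (fun p : ℝ × EuclideanSpace ℝ (Fin d) => p.2 + p.1 • v)
      ((volume.restrict (uIoc a b)).prod volume) volume := by
  have h := (MeasurePreserving.id (volume.restrict (uIoc a b))).skew_product
    (μc := (volume : Measure (EuclideanSpace ℝ (Fin d)))) (μd := volume)
    (g := fun s y => y + s • v) (by unfold Function.uncurry; fun_prop)
    (ae_of_all _ fun s => map_add_right_eq_self _ _)
  exact Measure.quasiMeasurePreserving_snd.comp h.quasiMeasurePreserving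

theorem integrable_comp_add_smul_mul {g k : EuclideanSpace ℝ (Fin d) → ℝ}
    (hg : LocallyIntegrable g) (hk : AEStronglyMeasurable k) {B r : ℝ} (hB : ∀ z, |k z| ≤ B)
    (hr : ∀ z, z ∉ Metric.closedBall (0 : EuclideanSpace ℝ (Fin d)) r → k z = 0)
    (v : EuclideanSpace ℝ (Fin d)) (t : ℝ) :
    Integrable (Function.uncurry fun (s : ℝ) z => g (z + s • v) * k z)
      ((volume.restrict (uIoc 0 t)).prod volume) := by
  have hmeas : AEStronglyMeasurable (Function.uncurry fun (s : ℝ) z => g (z + s • v) * k z)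
      ((volume.restrict (uIoc 0 t)).prod volume) :=
    (hg.aestronglyMeasurable.comp_quasiMeasurePreserving (quasiMeasurePreserving_add_smul v 0 t)).mul
      hk.comp_snd
  set K := Metric.closedBall (0 : EuclideanSpace ℝ (Fin d)) (r + |t| * ‖v‖)
  have hK : IntegrableOn g K := hg.integrableOn_isCompact (isCompact_closedBall _ _)
  have hbound : ∀ s ∈ uIoc 0 t, ∀ z, ‖g (z + s • v) * k z‖ₑ ≤
      ENNReal.ofReal B * K.indicator (fun z => ‖g z‖ₑ) (z + s • v) := by
    intro s hs z
    by_cases hz : z ∈ Metric.closedBall (0 : EuclideanSpace ℝ (Fin d)) r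
    · have hs' : |s| ≤ |t| := by
        rcases le_total 0 t with h | h
        · rw [uIoc_of_le h] at hs; rw [abs_of_pos hs.1, abs_of_nonneg h]; exact hs.2
        · rw [uIoc_of_ge h] at hs; rw [abs_of_nonpos hs.2, abs_of_nonpos h]; linarith [hs.1]
      have : z + s • v ∈ K := by
        rw [mem_closedBall_zero_iff] at hz ⊢
        refine (norm_add_le _ _).trans (add_le_add hz ?_)
        rw [norm_smul, Real.norm_eq_abs]; gcongr
      rw [indicator_of_mem this, enorm_mul, mul_comm]
      gcongr
      rw [Real.enorm_eq_ofReal_abs]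
      exact ENNReal.ofReal_le_ofReal (hB z)
    · simp [hr z hz]
  refine ⟨hmeas, ?_⟩
  rw [hasFiniteIntegral_iff_enorm, lintegral_prod _ hmeas.enorm]
  calc ∫⁻ s in uIoc 0 t, ∫⁻ z, ‖g (z + s • v) * k z‖ₑ
      ≤ ∫⁻ s in uIoc 0 t, ENNReal.ofReal B * ∫⁻ z in K, ‖g z‖ₑ := by
        refine setLIntegral_mono' measurableSet_uIoc fun s hs => ?_
        refine (lintegral_mono (hbound s hs)).trans ?_
        rw [lintegral_const_mul' _ _ ENNReal.ofReal_ne_top,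
          lintegral_add_right_eq_self (μ := volume) (K.indicator fun z => ‖g z‖ₑ) (s • v),
          lintegral_indicator Metric.isClosed_closedBall.measurableSet]
    _ < ⊤ := by
        rw [setLIntegral_const]
        refine ENNReal.mul_lt_top (ENNReal.mul_lt_top ENNReal.ofReal_lt_top ?_) ?_
        · exact hK.2
        · rw [uIoc]; exact measure_Ioc_lt_top

theorem integrable_mul_of_bounded {g k : EuclideanSpace ℝ (Fin d) → ℝ}
    (hg : LocallyIntegrable g) (hk : AEStronglyMeasurable k) {B r : ℝ} (hB : ∀ z, |k z| ≤ B)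
    (hr : ∀ z, z ∉ Metric.closedBall (0 : EuclideanSpace ℝ (Fin d)) r → k z = 0) :
    Integrable fun z => g z * k z := by
  have hK : IntegrableOn g (Metric.closedBall (0 : EuclideanSpace ℝ (Fin d)) r) :=
    hg.integrableOn_isCompact (isCompact_closedBall _ _)
  have h1 : Integrable (fun z => (Metric.closedBall (0 : EuclideanSpace ℝ (Fin d)) r).indicator g z
      * k z) :=
    (hK.integrable_indicator Metric.isClosed_closedBall.measurableSet).mul_bdd hk
      (ae_of_all _ hB)
  refine h1.congr (ae_of_all _ fun z => ?_)
  by_cases hz : z ∈ Metric.closedBall (0 : EuclideanSpace ℝ (Fin d)) r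
  · simp [hz]
  · simp [hr z hz]

theorem locallyIntegrable_comp_add_right {g : EuclideanSpace ℝ (Fin d) → ℝ}
    (hg : LocallyIntegrable g) (w : EuclideanSpace ℝ (Fin d)) :
    LocallyIntegrable fun z => g (z + w) := by
  rw [locallyIntegrable_iff]
  intro K hK
  have h1 : IntegrableOn g ((fun z => z + w) '' K) :=
    hg.integrableOn_isCompact (hK.image (by fun_prop))
  exact ((measurePreserving_add_right volume w).integrableOn_image
    (measurableEmbedding_addRight w)).1 h1

theorem exists_bound_of_hasCompactSupport {φ : EuclideanSpace ℝ (Fin d) → ℝ} (hφ : Continuous φ)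
    (hc : HasCompactSupport φ) : ∃ B r : ℝ, (∀ z, |φ z| ≤ B) ∧
      ∀ z, z ∉ Metric.closedBall (0 : EuclideanSpace ℝ (Fin d)) r → φ z = 0 := by
  obtain ⟨B, hB⟩ := hφ.bounded_above_of_compact_support hc
  obtain ⟨r, hr⟩ := hc.isCompact.isBounded.subset_closedBall (0 : EuclideanSpace ℝ (Fin d))
  refine ⟨B, r, hB, fun z hz => ?_⟩
  by_contra h
  exact hz (hr (subset_tsupport _ h))

/-- The translation is moved onto `φ`, whose increment is the integral of its derivative along the
segment; Fubini's theorem and the definition of `g`, tested with translates of `φ`, finish. -/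
theorem HasWeakPartial.integral_comp_add_sub_mul {l : Fin d} {f g : EuclideanSpace ℝ (Fin d) → ℝ}
    (h : HasWeakPartial l f g) {φ : EuclideanSpace ℝ (Fin d) → ℝ} (hφ : ContDiff ℝ ∞ φ)
    (hc : HasCompactSupport φ) (t : ℝ) :
    ∫ z, (f (z + t • EuclideanSpace.single l 1) - f z) * φ z =
      ∫ s in (0 : ℝ)..t, ∫ z, g (z + s • EuclideanSpace.single l 1) * φ z := by
  set e : EuclideanSpace ℝ (Fin d) := EuclideanSpace.single l 1
  obtain ⟨B, r, hB, hr⟩ := exists_bound_of_hasCompactSupport hφ.continuous hc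
  set ψ := fun z => fderiv ℝ φ z e
  have hψ : Continuous ψ := (hφ.continuous_fderiv (by simp)).clm_apply continuous_const
  have hψc : HasCompactSupport ψ := hc.fderiv_apply (𝕜 := ℝ) e
  obtain ⟨B', r', hB', hr'⟩ := exists_bound_of_hasCompactSupport hψ hψc
  have hshift (k : EuclideanSpace ℝ (Fin d) → ℝ) (u : EuclideanSpace ℝ (Fin d) → ℝ) (s : ℝ) :
      ∫ z, u (z + s • e) * k z = ∫ z, u z * k (z - s • e) := by
    have := integral_add_right_eq_self (μ := volume) (fun z => u z * k (z - s • e)) (s • e)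
    simpa using this
  have hderiv (z : EuclideanSpace ℝ (Fin d)) :
      ∫ s in (0 : ℝ)..t, -ψ (z - s • e) = φ (z - t • e) - φ z := by
    have h1 (s : ℝ) : HasDerivAt (fun s : ℝ => φ (z - s • e)) (-ψ (z - s • e)) s := by
      have h2 : HasDerivAt (fun s : ℝ => z - s • e) (-((1 : ℝ) • e)) s :=
        ((hasDerivAt_id s).smul_const e).const_sub z
      have h3 := ((hφ.differentiable (by simp) (z - s • e)).hasFDerivAt).comp_hasDerivAt s h2
      have h4 : fderiv ℝ φ (z - s • e) (-((1 : ℝ) • e)) = -ψ (z - s • e) := by simp [ψ]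
      rw [h4] at h3
      exact h3
    have h4 := intervalIntegral.integral_eq_sub_of_hasDerivAt (a := 0) (b := t) (fun s _ => h1 s)
      ((by fun_prop : Continuous fun s : ℝ => -ψ (z - s • e)).intervalIntegrable _ _)
    simpa using h4
  have hI : Integrable (Function.uncurry fun (s : ℝ) z => f z * -ψ (z - s • e))
      ((volume.restrict (uIoc 0 t)).prod volume) := by
    have h1 : Integrable (fun z =>
        (Metric.closedBall (0 : EuclideanSpace ℝ (Fin d)) (r' + |t| * ‖e‖)).indicator f z) :=
      (h.1.integrableOn_isCompact (isCompact_closedBall _ _)).integrable_indicator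
        Metric.isClosed_closedBall.measurableSet
    have hfin : IsFiniteMeasure (volume.restrict (uIoc 0 t)) := by
      rw [uIoc]; infer_instance
    have h2 := (h1.comp_snd (volume.restrict (uIoc 0 t))).mul_bdd
      (g := fun p : ℝ × EuclideanSpace ℝ (Fin d) => -ψ (p.2 - p.1 • e))
      (by fun_prop : Continuous fun p : ℝ × EuclideanSpace ℝ (Fin d) =>
        -ψ (p.2 - p.1 • e)).aestronglyMeasurable (ae_of_all _ fun p => by simpa using hB' _)
    refine h2.congr ?_
    have h3 : ∀ᵐ p : ℝ × EuclideanSpace ℝ (Fin d) ∂((volume.restrict (uIoc 0 t)).prod volume),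
        p.1 ∈ uIoc 0 t :=
      Measure.quasiMeasurePreserving_fst.ae (ae_restrict_mem measurableSet_uIoc)
    filter_upwards [h3] with p hp
    by_cases hz : p.2 ∈ Metric.closedBall (0 : EuclideanSpace ℝ (Fin d)) (r' + |t| * ‖e‖)
    · simp [Function.uncurry, hz]
    · have : ψ (p.2 - p.1 • e) = 0 := by
        refine hr' _ fun hmem => hz ?_
        rw [mem_closedBall_zero_iff] at hmem ⊢
        have hs' : |p.1| ≤ |t| := by
          rcases le_total 0 t with h | h
          · rw [uIoc_of_le h] at hp; rw [abs_of_pos hp.1, abs_of_nonneg h]; exact hp.2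
          · rw [uIoc_of_ge h] at hp; rw [abs_of_nonpos hp.2, abs_of_nonpos h]; linarith [hp.1]
        calc ‖p.2‖ = ‖(p.2 - p.1 • e) + p.1 • e‖ := by simp
          _ ≤ _ := norm_add_le _ _
          _ ≤ _ := add_le_add hmem (by rw [norm_smul, Real.norm_eq_abs]; gcongr)
      simp [Function.uncurry, this]
  have hf1 : Integrable fun z => f z * φ z :=
    integrable_mul_of_bounded h.1 hφ.continuous.aestronglyMeasurable hB hr
  have hf2 : Integrable fun z => f (z + t • e) * φ z :=
    integrable_mul_of_bounded (locallyIntegrable_comp_add_right h.1 _)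
      hφ.continuous.aestronglyMeasurable hB hr
  have hf3 : Integrable fun z => f z * φ (z - t • e) := by
    have := hf2.comp_add_right (-(t • e))
    simpa [sub_eq_add_neg] using this
  calc ∫ z, (f (z + t • e) - f z) * φ z
      = ∫ z, f z * (φ (z - t • e) - φ z) := by
        simp_rw [sub_mul, mul_sub]
        rw [integral_sub hf2 hf1, integral_sub hf3 hf1, hshift]
    _ = ∫ z, ∫ s in (0 : ℝ)..t, f z * -ψ (z - s • e) := by
        simp_rw [intervalIntegral.integral_const_mul, hderiv]
    _ = ∫ s in (0 : ℝ)..t, ∫ z, f z * -ψ (z - s • e) := (intervalIntegral_integral_swap hI).symm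
    _ = _ := by
        refine intervalIntegral.integral_congr fun s _ => ?_
        have h1 := h.2.2 (fun z => φ (z - s • e)) (hφ.comp (by fun_prop))
          (hc.comp_homeomorph (Homeomorph.subRight (s • e)))
        simp only [fderiv_comp_sub] at h1
        simp only [mul_neg, integral_neg]
        rw [hshift]
        exact neg_eq_iff_eq_neg.2 h1

theorem locallyIntegrable_intervalIntegral_comp_add_smul {g : EuclideanSpace ℝ (Fin d) → ℝ}
    (hg : LocallyIntegrable g) (v : EuclideanSpace ℝ (Fin d)) (t : ℝ) :
    LocallyIntegrable fun z => ∫ s in (0 : ℝ)..t, g (z + s • v) := by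
  rw [locallyIntegrable_iff]
  intro K hK
  obtain ⟨r, hr⟩ := hK.isBounded.subset_closedBall (0 : EuclideanSpace ℝ (Fin d))
  have h1 := integrable_comp_add_smul_mul hg (k := (Metric.closedBall
    (0 : EuclideanSpace ℝ (Fin d)) r).indicator 1) (B := 1) (r := r)
    (measurable_one.indicator Metric.isClosed_closedBall.measurableSet).aestronglyMeasurable
    (fun z => by by_cases hz : z ∈ Metric.closedBall (0 : EuclideanSpace ℝ (Fin d)) r <;> simp [hz])
    (fun z hz => indicator_of_notMem hz _) v t
  have h2 := h1.integral_prod_right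
  have h3 : IntegrableOn (fun z => ∫ s in uIoc 0 t, g (z + s • v)) K := by
    refine IntegrableOn.congr_fun h2.integrableOn (fun z hz => ?_) hK.measurableSet
    simp [Function.uncurry, indicator_of_mem (hr hz)]
  simp_rw [intervalIntegral.intervalIntegral_eq_integral_uIoc]
  exact Integrable.smul (if (0 : ℝ) ≤ t then (1 : ℝ) else -1) h3

theorem HasWeakPartial.comp_add_sub_ae_eq {l : Fin d} {f g : EuclideanSpace ℝ (Fin d) → ℝ}
    (h : HasWeakPartial l f g) (t : ℝ) :
    ∀ᵐ z, f (z + t • EuclideanSpace.single l 1) - f z =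
      ∫ s in (0 : ℝ)..t, g (z + s • EuclideanSpace.single l 1) := by
  refine ae_eq_of_integral_contDiff_smul_eq
    ((locallyIntegrable_comp_add_right h.1 _).sub h.1)
    (locallyIntegrable_intervalIntegral_comp_add_smul h.2.1 _ t) fun φ hφ hc => ?_
  obtain ⟨B, r, hB, hr⟩ := exists_bound_of_hasCompactSupport hφ.continuous hc
  have h1 := h.integral_comp_add_sub_mul hφ hc t
  rw [intervalIntegral_integral_swap (integrable_comp_add_smul_mul h.2.1
    hφ.continuous.aestronglyMeasurable hB hr _ t)] at h1
  simp_rw [intervalIntegral.integral_mul_const] at h1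
  simpa [mul_comm] using h1

/-- The fundamental theorem of calculus for `f` holds only off a null set depending on `t`.
Integration against a kernel absorbs that set, so here every `x` and `t` is admitted. -/
theorem HasWeakPartial.integral_kernel_sub {l : Fin d} {f g : EuclideanSpace ℝ (Fin d) → ℝ}
    (h : HasWeakPartial l f g) {k : EuclideanSpace ℝ (Fin d) → ℝ}
    (hk : AEStronglyMeasurable k) {B r : ℝ} (hB : ∀ z, |k z| ≤ B)
    (hr : ∀ z, z ∉ Metric.closedBall (0 : EuclideanSpace ℝ (Fin d)) r → k z = 0)
    (x : EuclideanSpace ℝ (Fin d)) (t : ℝ) :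
    (∫ y, f (y + (x + t • EuclideanSpace.single l 1)) * k y) - ∫ y, f (y + x) * k y =
      ∫ s in (0 : ℝ)..t, ∫ y, g (y + (x + s • EuclideanSpace.single l 1)) * k y := by
  set e : EuclideanSpace ℝ (Fin d) := EuclideanSpace.single l 1
  have h1 := integrable_mul_of_bounded
    (locallyIntegrable_comp_add_right h.1 (x + t • e)) hk hB hr
  have h2 := integrable_mul_of_bounded (locallyIntegrable_comp_add_right h.1 x) hk hB hr
  have h3 := integrable_comp_add_smul_mul (locallyIntegrable_comp_add_right h.2.1 x) hk hB hr e t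
  have h4 : ∀ᵐ y, f (y + x + t • e) - f (y + x) = ∫ s in (0 : ℝ)..t, g (y + x + s • e) :=
    (measurePreserving_add_right volume x).quasiMeasurePreserving.ae (h.comp_add_sub_ae_eq t)
  rw [← integral_sub h1 h2]
  have e1 (y : EuclideanSpace ℝ (Fin d)) (s : ℝ) : y + (x + s • e) = y + s • e + x := by abel
  have e2 (y : EuclideanSpace ℝ (Fin d)) (s : ℝ) : y + s • e + x = y + x + s • e := by abel
  simp_rw [e1]
  rw [intervalIntegral_integral_swap h3]
  refine integral_congr_ae ?_
  filter_upwards [h4] with y hy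
  simp_rw [e2, ← sub_mul, intervalIntegral.integral_mul_const, ← hy]

theorem enorm_integral_kernel_le_average {f k : EuclideanSpace ℝ (Fin d) → ℝ}
    {a b : EuclideanSpace ℝ (Fin d)} (h0 : 0 ∈ openRectangle a b)
    (hk : ∀ y, ‖k y‖ₑ ≤ (openRectangle a b).indicator (fun _ => (volume (openRectangle a b))⁻¹) y)
    (x : EuclideanSpace ℝ (Fin d)) :
    ‖∫ y, f (y + x) * k y‖ₑ ≤
      (volume (openRectangle (x + a) (x + b)))⁻¹ * ∫⁻ y in openRectangle (x + a) (x + b), ‖f y‖ₑ := by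
  have hvol : volume (openRectangle (x + a) (x + b)) = volume (openRectangle a b) := by
    simp_rw [volume_openRectangle]; simp
  have hset : (fun y => y + x) ⁻¹' openRectangle (x + a) (x + b) = openRectangle a b := by
    ext y; simp [openRectangle, add_comm (x.ofLp _)]
  refine (enorm_integral_le_lintegral_enorm _).trans ?_
  have h := (measurePreserving_add_right (volume : Measure (EuclideanSpace ℝ (Fin d)))
    x).setLIntegral_comp_preimage_emb (measurableEmbedding_addRight x) (fun y => ‖f y‖ₑ)
    (openRectangle (x + a) (x + b))
  rw [← h, hset, hvol, ← lintegral_const_mul', ← lintegral_indicator]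
  · refine lintegral_mono fun y => ?_
    rw [enorm_mul, mul_comm]
    refine (mul_le_mul_left (hk y) _).trans (le_of_eq ?_)
    by_cases hy : y ∈ openRectangle a b <;> simp [hy]
  · exact (isOpen_openRectangle a b).measurableSet
  · rw [ENNReal.inv_ne_top, volume_openRectangle, Finset.prod_ne_zero_iff]
    intro i _
    simpa using (h0 i).1.trans (h0 i).2

end Translation

/-! ### Linearization: the maximal function as a sup norm -/

variable {d m : ℕ}

/-- Tuples of kernels bounded by the normalized indicator of a common rectangle around `0`. -/
structure KernelTuple (d m : ℕ) where
  kernel : Fin m → EuclideanSpace ℝ (Fin d) → ℝ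
  lower : EuclideanSpace ℝ (Fin d)
  upper : EuclideanSpace ℝ (Fin d)
  zero_mem : 0 ∈ openRectangle lower upper
  aestronglyMeasurable : ∀ i, AEStronglyMeasurable (kernel i)
  enorm_le : ∀ i y, ‖kernel i y‖ₑ ≤
    (openRectangle lower upper).indicator (fun _ => (volume (openRectangle lower upper))⁻¹) y

/-- With the discrete topology, `KernelTuple d m →ᵇ ℝ` consists of all bounded functions of the
tuple. -/
instance : TopologicalSpace (KernelTuple d m) := ⊥

instance : DiscreteTopology (KernelTuple d m) := ⟨rfl⟩

theorem volume_openRectangle_ne_zero {a b x : EuclideanSpace ℝ (Fin d)}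
    (hx : x ∈ openRectangle a b) : volume (openRectangle a b) ≠ 0 :=
  ((isOpen_openRectangle a b).measure_pos volume ⟨x, hx⟩).ne'

theorem volume_openRectangle_ne_top (a b : EuclideanSpace ℝ (Fin d)) :
    volume (openRectangle a b) ≠ ⊤ := by
  rw [volume_openRectangle]
  exact ENNReal.prod_ne_top fun i _ => ENNReal.ofReal_ne_top

namespace KernelTuple

theorem exists_bound (θ : KernelTuple d m) (i : Fin m) : ∃ B : ℝ, ∀ z, |θ.kernel i z| ≤ B := by
  have hfin : (volume (openRectangle θ.lower θ.upper))⁻¹ ≠ ⊤ :=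
    ENNReal.inv_ne_top.2 (volume_openRectangle_ne_zero θ.zero_mem)
  refine ⟨((volume (openRectangle θ.lower θ.upper))⁻¹).toReal, fun z => ?_⟩
  have h := (θ.enorm_le i z).trans (indicator_le_self _ _ _)
  have h2 := ENNReal.toReal_mono hfin h
  rwa [toReal_enorm, Real.norm_eq_abs] at h2

theorem exists_support (θ : KernelTuple d m) (i : Fin m) :
    ∃ r : ℝ, ∀ z, z ∉ Metric.closedBall (0 : EuclideanSpace ℝ (Fin d)) r → θ.kernel i z = 0 := by
  refine ⟨‖(WithLp.toLp 2 fun k => |θ.lower k| + |θ.upper k| : EuclideanSpace ℝ (Fin d))‖,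
    fun z hz => ?_⟩
  have hz' : z ∉ openRectangle θ.lower θ.upper := by
    refine fun hmem => hz ?_
    rw [mem_closedBall_zero_iff, EuclideanSpace.norm_eq, EuclideanSpace.norm_eq]
    refine Real.sqrt_le_sqrt (Finset.sum_le_sum fun k _ => ?_)
    simp only [Real.norm_eq_abs]
    have h1 := hmem k
    rw [sq_le_sq, abs_abs, abs_abs]
    refine le_trans ?_ (le_abs_self _)
    refine abs_le.2 ⟨?_, ?_⟩
    · linarith [neg_abs_le (θ.lower k), abs_nonneg (θ.upper k), h1.1]
    · linarith [le_abs_self (θ.upper k), abs_nonneg (θ.lower k), h1.2]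
  have h := θ.enorm_le i z
  rw [indicator_of_notMem hz'] at h
  simpa using h

theorem integrable_mul (θ : KernelTuple d m) (i : Fin m) {f : EuclideanSpace ℝ (Fin d) → ℝ}
    (hf : LocallyIntegrable f) (x : EuclideanSpace ℝ (Fin d)) :
    Integrable fun y => f (y + x) * θ.kernel i y := by
  obtain ⟨B, hB⟩ := θ.exists_bound i
  obtain ⟨r, hr⟩ := θ.exists_support i
  exact integrable_mul_of_bounded (locallyIntegrable_comp_add_right hf x)
    (θ.aestronglyMeasurable i) hB hr

/-- The average of `f` around `x` with respect to the `i`-th kernel. -/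
noncomputable def average (θ : KernelTuple d m) (i : Fin m) (f : EuclideanSpace ℝ (Fin d) → ℝ)
    (x : EuclideanSpace ℝ (Fin d)) : ℝ :=
  ∫ y, f (y + x) * θ.kernel i y

theorem add_mem_openRectangle (θ : KernelTuple d m) (x : EuclideanSpace ℝ (Fin d)) :
    x ∈ openRectangle (x + θ.lower) (x + θ.upper) := by
  intro k
  have := θ.zero_mem k
  simpa using this

theorem enorm_average_le (θ : KernelTuple d m) (i : Fin m) (f : EuclideanSpace ℝ (Fin d) → ℝ)
    (x : EuclideanSpace ℝ (Fin d)) : ‖θ.average i f x‖ₑ ≤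
      (volume (openRectangle (x + θ.lower) (x + θ.upper)))⁻¹ *
        ∫⁻ y in openRectangle (x + θ.lower) (x + θ.upper), ‖f y‖ₑ :=
  enorm_integral_kernel_le_average θ.zero_mem (θ.enorm_le i) x

theorem enorm_average_le_rectMax (θ : KernelTuple d m) (i : Fin m)
    (f : EuclideanSpace ℝ (Fin d) → ℝ) (x : EuclideanSpace ℝ (Fin d)) :
    ‖θ.average i f x‖ₑ ≤ rectMax (fun y => ‖f y‖ₑ) x :=
  (θ.enorm_average_le i f x).trans (average_le_rectMax _ (θ.add_mem_openRectangle x))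

theorem prod_enorm_average_le (θ : KernelTuple d m) (f : Fin m → EuclideanSpace ℝ (Fin d) → ℝ)
    (x : EuclideanSpace ℝ (Fin d)) : ∏ i, ‖θ.average i (f i) x‖ₑ ≤ strongMaximal f x :=
  (Finset.prod_le_prod' fun i _ => θ.enorm_average_le i (f i) x).trans
    (le_iSup_of_le _ (le_iSup_of_le _ (le_iSup_of_le (θ.add_mem_openRectangle x) le_rfl)))

theorem average_sub (θ : KernelTuple d m) (i : Fin m) {f g : EuclideanSpace ℝ (Fin d) → ℝ}
    (hf : LocallyIntegrable f) (hg : LocallyIntegrable g) (x : EuclideanSpace ℝ (Fin d)) :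
    θ.average i (f - g) x = θ.average i f x - θ.average i g x := by
  rw [average, average, average, ← integral_sub (θ.integrable_mul i hf x) (θ.integrable_mul i hg x)]
  simp [sub_mul]

/-- The extremal kernel is the normalized indicator of the translated rectangle times the sign of `f
i (· + x)`. Since it depends on `f` and `x`, the index set has to contain all measurable kernels
with the given bound. -/
theorem exists_average_eq {f : Fin m → EuclideanSpace ℝ (Fin d) → ℝ}
    (hf : ∀ i, LocallyIntegrable (f i)) {a b x : EuclideanSpace ℝ (Fin d)}
    (hx : x ∈ openRectangle a b) : ∃ θ : KernelTuple d m, ∀ i, ‖θ.average i (f i) x‖ₑ =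
      (volume (openRectangle a b))⁻¹ * ∫⁻ y in openRectangle a b, ‖f i y‖ₑ := by
  have hopen := isOpen_openRectangle a b
  have h0 := volume_openRectangle_ne_zero hx
  have hpre : (fun y => y + x) ⁻¹' openRectangle a b = openRectangle (a - x) (b - x) := by
    ext y; simp [openRectangle, sub_lt_iff_lt_add, lt_sub_iff_add_lt]
  have hvol : volume (openRectangle (a - x) (b - x)) = volume (openRectangle a b) := by
    simp_rw [volume_openRectangle]; simp
  set c := ((volume (openRectangle a b))⁻¹).toReal with hc
  have hc' : ENNReal.ofReal c = (volume (openRectangle a b))⁻¹ :=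
    ENNReal.ofReal_toReal (ENNReal.inv_ne_top.2 h0)
  refine ⟨⟨fun i => (openRectangle (a - x) (b - x)).indicator
    fun y => c * SignType.sign (f i (y + x)), a - x, b - x, ?_, ?_, ?_⟩, ?_⟩
  · intro k
    simpa using hx k
  · intro i
    have h1 : AEMeasurable (fun y => f i (y + x)) :=
      (locallyIntegrable_comp_add_right (hf i) x).aestronglyMeasurable.aemeasurable
    have h2 : Measurable fun r : ℝ => c * ((SignType.sign r : SignType) : ℝ) := by
      refine Measurable.const_mul ?_ c
      have : (fun r : ℝ => ((SignType.sign r : SignType) : ℝ)) =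
          fun r => if 0 < r then 1 else if r < 0 then -1 else 0 := by
        funext r; simp only [sign_apply]; split_ifs <;> simp
      rw [this]
      exact Measurable.ite measurableSet_Ioi measurable_const
        (Measurable.ite measurableSet_Iio measurable_const measurable_const)
    exact ((h2.comp_aemeasurable h1).aestronglyMeasurable).indicator
      (isOpen_openRectangle _ _).measurableSet
  · intro i y
    by_cases hy : y ∈ openRectangle (a - x) (b - x)
    · rw [indicator_of_mem hy, indicator_of_mem hy, enorm_mul, hvol, ← hc',
        Real.enorm_of_nonneg (by positivity)]
      refine mul_le_of_le_one_right' ?_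
      rcases lt_trichotomy (f i (y + x)) 0 with h | h | h <;> simp [h]
    · simp [hy]
  · intro i
    have h1 (y : EuclideanSpace ℝ (Fin d)) : f i (y + x) * (openRectangle (a - x) (b - x)).indicator
        (fun y => c * SignType.sign (f i (y + x))) y =
        (openRectangle (a - x) (b - x)).indicator (fun y => c * |f i (y + x)|) y := by
      by_cases hy : y ∈ openRectangle (a - x) (b - x)
      · rw [indicator_of_mem hy, indicator_of_mem hy, ← self_mul_sign]; ring
      · simp [hy]
    have h2 := (measurePreserving_add_right (volume : Measure (EuclideanSpace ℝ (Fin d)))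
      x).setLIntegral_comp_preimage_emb (measurableEmbedding_addRight x) (fun y => ‖f i y‖ₑ)
      (openRectangle a b)
    have h3 : AEStronglyMeasurable (fun y => f i (y + x)) :=
      (locallyIntegrable_comp_add_right (hf i) x).aestronglyMeasurable
    simp only [average, h1]
    rw [integral_indicator (isOpen_openRectangle _ _).measurableSet, integral_const_mul, enorm_mul,
      Real.enorm_of_nonneg (by positivity), hc', ← h2, hpre,
      integral_eq_lintegral_of_nonneg_ae (ae_of_all _ fun _ => abs_nonneg _) h3.norm.restrict,
      Real.enorm_of_nonneg (by positivity), ENNReal.ofReal_toReal]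
    · simp_rw [Real.enorm_eq_ofReal_abs]
    · have h4 : IntegrableOn (fun y => f i (y + x)) (openRectangle (a - x) (b - x)) := by
        -- An auxiliary tuple with the constant kernel `c ≠ 0` on the rectangle: its support bound
        -- places the rectangle inside a ball, where `f i (· + x)` is integrable.
        obtain ⟨r, hr⟩ := exists_support (m := 1) ⟨fun _ =>
          (openRectangle (a - x) (b - x)).indicator fun _ => c, a - x, b - x, fun k => by
            simpa using hx k, fun _ => aestronglyMeasurable_const.indicator
            (isOpen_openRectangle _ _).measurableSet, fun _ y => by
              by_cases hy : y ∈ openRectangle (a - x) (b - x) <;>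
                simp [hy, hvol, ← hc', Real.enorm_of_nonneg (show 0 ≤ c by positivity)]⟩ 0
        refine ((locallyIntegrable_comp_add_right (hf i) x).integrableOn_isCompact
          (isCompact_closedBall 0 r)).mono_set fun y hy => ?_
        by_contra hcon
        have h5 := hr y hcon
        simp only [indicator_of_mem hy] at h5
        rw [h5, ENNReal.ofReal_zero] at hc'
        exact ENNReal.inv_ne_zero.2 (volume_openRectangle_ne_top a b) hc'.symm
      have h5 := h4.2
      rw [hasFiniteIntegral_iff_enorm] at h5
      simpa only [Real.enorm_eq_ofReal_abs] using h5.ne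

end KernelTuple

/-- All kernel averages of `f` around `x`, as a bounded function of the kernel tuple. -/
noncomputable def averageMap (i : Fin m) (f : EuclideanSpace ℝ (Fin d) → ℝ)
    (x : EuclideanSpace ℝ (Fin d)) : KernelTuple d m →ᵇ ℝ :=
  open scoped Classical in
  -- Finiteness of `rectMax` bounds the averages uniformly in the tuple; otherwise the value is `0`
  -- by convention.
  if h : rectMax (fun y => ‖f y‖ₑ) x < ⊤ then
    BoundedContinuousFunction.ofNormedAddCommGroupDiscrete (fun θ => θ.average i f x)
      (rectMax (fun y => ‖f y‖ₑ) x).toReal fun θ => by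
        have := ENNReal.toReal_mono h.ne (θ.enorm_average_le_rectMax i f x)
        rwa [toReal_enorm] at this
  else 0

theorem averageMap_apply (i : Fin m) {f : EuclideanSpace ℝ (Fin d) → ℝ}
    {x : EuclideanSpace ℝ (Fin d)} (h : rectMax (fun y => ‖f y‖ₑ) x < ⊤) (θ : KernelTuple d m) :
    averageMap i f x θ = θ.average i f x := by
  rw [averageMap, dif_pos h]; rfl

theorem BoundedContinuousFunction.enorm_le_of_forall {α : Type*} [TopologicalSpace α] {u : α →ᵇ ℝ}
    {c : ℝ≥0∞} (h : ∀ a, ‖u a‖ₑ ≤ c) : ‖u‖ₑ ≤ c := by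
  by_cases hc : c = ⊤
  · rw [hc]; exact le_top
  rw [← ENNReal.ofReal_toReal hc, ← ofReal_norm]
  refine ENNReal.ofReal_le_ofReal ((BoundedContinuousFunction.norm_le ENNReal.toReal_nonneg).2
    fun a => ?_)
  have := ENNReal.toReal_mono hc (h a)
  rwa [toReal_enorm] at this

theorem BoundedContinuousFunction.enorm_coe_le {α : Type*} [TopologicalSpace α] (u : α →ᵇ ℝ)
    (a : α) : ‖u a‖ₑ ≤ ‖u‖ₑ := by
  rw [← ofReal_norm, ← ofReal_norm]
  exact ENNReal.ofReal_le_ofReal (u.norm_coe_le_norm a)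

theorem enorm_averageMap_le (i : Fin m) (f : EuclideanSpace ℝ (Fin d) → ℝ)
    (x : EuclideanSpace ℝ (Fin d)) : ‖averageMap i f x‖ₑ ≤ rectMax (fun y => ‖f y‖ₑ) x := by
  by_cases h : rectMax (fun y => ‖f y‖ₑ) x < ⊤
  · refine BoundedContinuousFunction.enorm_le_of_forall fun θ => ?_
    rw [averageMap_apply i h]
    exact θ.enorm_average_le_rectMax i f x
  · rw [averageMap, dif_neg h]; exact (enorm_zero (E := KernelTuple d m →ᵇ ℝ)).trans_le zero_le

theorem enorm_averageMap_sub_le (i : Fin m) {f g : EuclideanSpace ℝ (Fin d) → ℝ}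
    (hf : LocallyIntegrable f) (hg : LocallyIntegrable g) {x : EuclideanSpace ℝ (Fin d)}
    (hfx : rectMax (fun y => ‖f y‖ₑ) x < ⊤) (hgx : rectMax (fun y => ‖g y‖ₑ) x < ⊤) :
    ‖averageMap i f x - averageMap i g x‖ₑ ≤ rectMax (fun y => ‖(f - g) y‖ₑ) x := by
  refine BoundedContinuousFunction.enorm_le_of_forall fun θ => ?_
  rw [BoundedContinuousFunction.sub_apply, averageMap_apply i hfx, averageMap_apply i hgx,
    ← θ.average_sub i hf hg]
  exact θ.enorm_average_le_rectMax i _ x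

/-- Every tuple gives a value below the supremum over rectangles, and `exists_average_eq` realizes
the value of each rectangle by one tuple, simultaneously for all `i`. -/
theorem enorm_prod_averageMap {f : Fin m → EuclideanSpace ℝ (Fin d) → ℝ}
    (hf : ∀ i, LocallyIntegrable (f i)) {x : EuclideanSpace ℝ (Fin d)}
    (hfx : ∀ i, rectMax (fun y => ‖f i y‖ₑ) x < ⊤) :
    ‖∏ i, averageMap i (f i) x‖ₑ = strongMaximal f x := by
  have key (θ : KernelTuple d m) :
      ‖(∏ i, averageMap i (f i) x) θ‖ₑ = ∏ i, ‖θ.average i (f i) x‖ₑ := by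
    rw [BoundedContinuousFunction.prod_apply, ← ofReal_norm, norm_prod,
      ENNReal.ofReal_prod_of_nonneg fun _ _ => norm_nonneg _]
    exact Finset.prod_congr rfl fun i _ => by rw [ofReal_norm, averageMap_apply i (hfx i)]
  refine le_antisymm (BoundedContinuousFunction.enorm_le_of_forall fun θ => ?_)
    (iSup_le fun a => iSup_le fun b => iSup_le fun hx => ?_)
  · rw [key]
    exact θ.prod_enorm_average_le f x
  · obtain ⟨θ, hθ⟩ := KernelTuple.exists_average_eq hf hx
    simp_rw [← hθ]
    rw [← key]
    exact BoundedContinuousFunction.enorm_coe_le _ θ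

theorem strongMaximalReal_eq_norm {f : Fin m → EuclideanSpace ℝ (Fin d) → ℝ}
    (hf : ∀ i, LocallyIntegrable (f i)) {x : EuclideanSpace ℝ (Fin d)}
    (hfx : ∀ i, rectMax (fun y => ‖f i y‖ₑ) x < ⊤) :
    strongMaximalReal f x = ‖∏ i, averageMap i (f i) x‖ := by
  rw [strongMaximalReal, ← enorm_prod_averageMap hf hfx, toReal_enorm]

theorem rectMax_le_const {f : EuclideanSpace ℝ (Fin d) → ℝ≥0∞} {c : ℝ≥0∞} (h : ∀ y, f y ≤ c)
    (x : EuclideanSpace ℝ (Fin d)) : rectMax f x ≤ c := by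
  refine iSup_le fun a => iSup_le fun b => iSup_le fun hx => ?_
  calc (volume (openRectangle a b))⁻¹ * ∫⁻ y in openRectangle a b, f y
      ≤ (volume (openRectangle a b))⁻¹ * ∫⁻ y in openRectangle a b, c := by gcongr; exact h _
    _ = c := by
      rw [setLIntegral_const, mul_left_comm, ENNReal.inv_mul_cancel (volume_openRectangle_ne_zero hx)
        (volume_openRectangle_ne_top a b), mul_one]

/-! ### Differentiability of the averages along a coordinate line -/

theorem KernelTuple.average_add_smul_sub (θ : KernelTuple d m) (i : Fin m) {l : Fin d}
    {f g : EuclideanSpace ℝ (Fin d) → ℝ} (h : HasWeakPartial l f g)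
    (x : EuclideanSpace ℝ (Fin d)) (t : ℝ) :
    θ.average i f (x + t • EuclideanSpace.single l 1) - θ.average i f x =
      ∫ s in (0 : ℝ)..t, θ.average i g (x + s • EuclideanSpace.single l 1) := by
  obtain ⟨B, hB⟩ := θ.exists_bound i
  obtain ⟨r, hr⟩ := θ.exists_support i
  exact h.integral_kernel_sub (θ.aestronglyMeasurable i) hB hr x t

theorem KernelTuple.intervalIntegrable_average (θ : KernelTuple d m) (i : Fin m)
    {g : EuclideanSpace ℝ (Fin d) → ℝ} (hg : LocallyIntegrable g)
    (x v : EuclideanSpace ℝ (Fin d)) (t : ℝ) :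
    IntervalIntegrable (fun s => θ.average i g (x + s • v)) volume 0 t := by
  obtain ⟨B, hB⟩ := θ.exists_bound i
  obtain ⟨r, hr⟩ := θ.exists_support i
  have h := (integrable_comp_add_smul_mul (locallyIntegrable_comp_add_right hg x)
    (θ.aestronglyMeasurable i) hB hr v t).integral_prod_left
  rw [intervalIntegrable_iff]
  refine h.congr (ae_of_all _ fun s => ?_)
  simp only [average, Function.uncurry]
  congr 1
  funext y
  congr 2
  abel

theorem enorm_intervalIntegral_le {u : ℝ → ℝ} {w : ℝ → ℝ≥0∞} {t : ℝ}
    (h : ∀ s ∈ uIcc 0 t, ‖u s‖ₑ ≤ w s) :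
    ‖∫ s in (0 : ℝ)..t, u s‖ₑ ≤ ∫⁻ s in uIcc 0 t, w s := by
  have h1 : ‖∫ s in (0 : ℝ)..t, u s‖ₑ = ‖∫ s in uIoc 0 t, u s‖ₑ := by
    rw [← ofReal_norm, ← ofReal_norm, intervalIntegral.norm_intervalIntegral_eq]
  rw [h1]
  refine (enorm_integral_le_lintegral_enorm _).trans ?_
  refine (lintegral_mono_set uIoc_subset_uIcc).trans ?_
  exact setLIntegral_mono' measurableSet_uIcc h

theorem KernelTuple.enorm_average_add_smul_sub_le (θ : KernelTuple d m) (i : Fin m) {l : Fin d}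
    {f g : EuclideanSpace ℝ (Fin d) → ℝ} (h : HasWeakPartial l f g)
    (x : EuclideanSpace ℝ (Fin d)) (t : ℝ) :
    ‖θ.average i f (x + t • EuclideanSpace.single l 1) - θ.average i f x‖ₑ ≤
      ENNReal.ofReal |t| * lineMax l (rectMax fun y => ‖g y‖ₑ) x := by
  rw [θ.average_add_smul_sub i h]
  exact (enorm_intervalIntegral_le fun s _ => θ.enorm_average_le_rectMax i g _).trans
    (lintegral_uIcc_le_lineMax l _ x t)

/-- Finiteness at `x` spreads to the whole line through `x`, because the averages change by at most
`|t|` times `lineMax` at `x`. Thus `averageMap` never takes its default value on that line. -/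
theorem rectMax_add_smul_lt_top {l : Fin d} {f g : EuclideanSpace ℝ (Fin d) → ℝ}
    (h : HasWeakPartial l f g) {x : EuclideanSpace ℝ (Fin d)}
    (hf : rectMax (fun y => ‖f y‖ₑ) x < ⊤) (hg : lineMax l (rectMax fun y => ‖g y‖ₑ) x < ⊤)
    (t : ℝ) : rectMax (fun y => ‖f y‖ₑ) (x + t • EuclideanSpace.single l 1) < ⊤ := by
  refine lt_of_le_of_lt (iSup_le fun a => iSup_le fun b => iSup_le fun hx => ?_)
    (ENNReal.add_lt_top.2 ⟨hf, ENNReal.mul_lt_top (ENNReal.ofReal_lt_top (r := |t|)) hg⟩)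
  obtain ⟨θ, hθ⟩ := KernelTuple.exists_average_eq (m := 1) (f := fun _ => f) (fun _ => h.1) hx
  rw [← hθ 0]
  calc _ = ‖θ.average 0 f x +
        (θ.average 0 f (x + t • EuclideanSpace.single l 1) - θ.average 0 f x)‖ₑ := by
        rw [add_sub_cancel]
    _ ≤ _ := (enorm_add_le _ _).trans (add_le_add (θ.enorm_average_le_rectMax 0 f x)
      (θ.enorm_average_add_smul_sub_le 0 h x t))

theorem enorm_averageMap_add_smul_sub_le (i : Fin m) {l : Fin d}
    {f g : EuclideanSpace ℝ (Fin d) → ℝ} (h : HasWeakPartial l f g)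
    {x : EuclideanSpace ℝ (Fin d)} (hf : rectMax (fun y => ‖f y‖ₑ) x < ⊤)
    (hg : lineMax l (rectMax fun y => ‖g y‖ₑ) x < ⊤) (t : ℝ) :
    ‖averageMap i f (x + t • EuclideanSpace.single l 1) - averageMap i f x‖ₑ ≤
      ENNReal.ofReal |t| * lineMax l (rectMax fun y => ‖g y‖ₑ) x := by
  refine BoundedContinuousFunction.enorm_le_of_forall fun θ => ?_
  rw [BoundedContinuousFunction.sub_apply, averageMap_apply i hf,
    averageMap_apply i (rectMax_add_smul_lt_top h hf hg t)]
  exact θ.enorm_average_add_smul_sub_le i h x t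

/-- At `x`, the function `g` is approximated by continuous functions with compact support, with
an error that is small with respect to the maximal functions. -/
def IsApproximable (l : Fin d) (g : EuclideanSpace ℝ (Fin d) → ℝ) (x : EuclideanSpace ℝ (Fin d)) :
    Prop :=
  ∀ ε : ℝ, 0 < ε → ∃ c : EuclideanSpace ℝ (Fin d) → ℝ, Continuous c ∧ HasCompactSupport c ∧
    rectMax (fun y => ‖(g - c) y‖ₑ) x ≤ ENNReal.ofReal ε ∧
      lineMax l (rectMax fun y => ‖(g - c) y‖ₑ) x ≤ ENNReal.ofReal ε

/-- The remainder is the integral of `θ.average i g (x + s • e) - θ.average i g x`. Writing `g = (g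
- c) + c`, the first part is controlled by maximal functions at `x` and the second by the
oscillation of `c`; nothing in the bound depends on `θ`. -/
theorem KernelTuple.enorm_average_sub_sub_le (θ : KernelTuple d m) (i : Fin m) {l : Fin d}
    {f g c : EuclideanSpace ℝ (Fin d) → ℝ} (h : HasWeakPartial l f g) (hc : Continuous c)
    {ε : ℝ≥0∞} {t : ℝ}
    (hct : ∀ s ∈ uIcc 0 t, ∀ y, ‖c (y + s • EuclideanSpace.single l 1) - c y‖ₑ ≤ ε)
    (x : EuclideanSpace ℝ (Fin d)) :
    ‖θ.average i f (x + t • EuclideanSpace.single l 1) - θ.average i f x - t * θ.average i g x‖ₑ ≤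
      ENNReal.ofReal |t| * (lineMax l (rectMax fun y => ‖(g - c) y‖ₑ) x +
        (rectMax (fun y => ‖(g - c) y‖ₑ) x + ε)) := by
  set e : EuclideanSpace ℝ (Fin d) := EuclideanSpace.single l 1
  have hcl : LocallyIntegrable c := hc.locallyIntegrable
  have h1 : θ.average i f (x + t • e) - θ.average i f x - t * θ.average i g x =
      ∫ s in (0 : ℝ)..t, (θ.average i g (x + s • e) - θ.average i g x) := by
    rw [intervalIntegral.integral_sub (θ.intervalIntegrable_average i h.2.1 x e t)
      intervalIntegrable_const, θ.average_add_smul_sub i h, intervalIntegral.integral_const]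
    simp [e]
  rw [h1]
  have h2 : ∀ s ∈ uIcc 0 t, ‖θ.average i g (x + s • e) - θ.average i g x‖ₑ ≤
      rectMax (fun y => ‖(g - c) y‖ₑ) (x + s • e) + (rectMax (fun y => ‖(g - c) y‖ₑ) x + ε) := by
    intro s hs
    have e1 : θ.average i c (x + s • e) = θ.average i (fun y => c (y + s • e)) x := by
      simp only [average]
      congr 1; funext y; congr 2; abel
    have e2 : θ.average i g (x + s • e) - θ.average i g x =
        θ.average i (g - c) (x + s • e) - θ.average i (g - c) x
          + θ.average i ((fun y => c (y + s • e)) - c) x := by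
      have hcs : Continuous fun y => c (y + s • e) := by fun_prop
      rw [θ.average_sub i h.2.1 hcl, θ.average_sub i h.2.1 hcl,
        θ.average_sub i hcs.locallyIntegrable hcl, ← e1]
      ring
    rw [e2, ← add_assoc]
    refine (enorm_add_le _ _).trans (add_le_add (enorm_sub_le.trans (add_le_add ?_ ?_)) ?_)
    · exact θ.enorm_average_le_rectMax i _ _
    · exact θ.enorm_average_le_rectMax i _ _
    · exact (θ.enorm_average_le_rectMax i _ _).trans (rectMax_le_const (hct s hs) x)
  refine (enorm_intervalIntegral_le h2).trans ?_
  rw [lintegral_add_right _ measurable_const, mul_add, setLIntegral_const]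
  refine add_le_add (lintegral_uIcc_le_lineMax l _ x t) (le_of_eq ?_)
  rw [uIcc, Real.volume_Icc, max_sub_min_eq_abs, sub_zero, mul_comm]

/-- The remainder bound is uniform over tuples, so differentiability of the individual averages
becomes differentiability in the sup norm. The three error terms receive `ε / 3` each. -/
theorem hasDerivAt_averageMap (i : Fin m) {l : Fin d}
    {f g : EuclideanSpace ℝ (Fin d) → ℝ} (h : HasWeakPartial l f g)
    {x : EuclideanSpace ℝ (Fin d)} (hf : rectMax (fun y => ‖f y‖ₑ) x < ⊤)
    (hg' : rectMax (fun y => ‖g y‖ₑ) x < ⊤)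
    (hg : lineMax l (rectMax fun y => ‖g y‖ₑ) x < ⊤) (happ : IsApproximable l g x) :
    HasDerivAt (fun t : ℝ => averageMap i f (x + t • EuclideanSpace.single l 1))
      (averageMap i g x : KernelTuple d m →ᵇ ℝ) 0 := by
  set e : EuclideanSpace ℝ (Fin d) := EuclideanSpace.single l 1 with he
  rw [hasDerivAt_iff_isLittleO, Asymptotics.isLittleO_iff]
  intro ε hε
  obtain ⟨c, hc, hcc, h1, h2⟩ := happ (ε / 3) (by positivity)
  obtain ⟨δ, hδ, huc⟩ := Metric.uniformContinuous_iff.1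
    (hc.uniformContinuous_of_tendsto_cocompact (hcc.is_zero_at_infty)) (ε / 3) (by positivity)
  have hδ' : ∀ᶠ t : ℝ in 𝓝 0, |t| < δ := by
    have : Tendsto (fun t : ℝ => |t|) (𝓝 0) (𝓝 |0|) := continuous_abs.tendsto 0
    rw [abs_zero] at this
    exact this.eventually_lt_const hδ
  filter_upwards [hδ'] with t ht
  have hnorm : ‖e‖ = 1 := by simp [he]
  have hct : ∀ s ∈ uIcc 0 t, ∀ y, ‖c (y + s • e) - c y‖ₑ ≤ ENNReal.ofReal (ε / 3) := by
    intro s hs y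
    rw [← ofReal_norm]
    refine ENNReal.ofReal_le_ofReal (le_of_lt ?_)
    have := huc (a := y + s • e) (b := y) (by
      rw [dist_eq_norm, add_sub_cancel_left, norm_smul, hnorm, mul_one, Real.norm_eq_abs]
      have := abs_sub_left_of_mem_uIcc hs
      simp only [sub_zero] at this
      linarith)
    rwa [dist_eq_norm] at this
  have key : ‖averageMap i f (x + t • e) - averageMap i f x - t • averageMap i g x‖ₑ ≤
      ENNReal.ofReal (ε * |t|) := by
    refine BoundedContinuousFunction.enorm_le_of_forall fun θ => ?_
    rw [BoundedContinuousFunction.sub_apply, BoundedContinuousFunction.sub_apply,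
      BoundedContinuousFunction.smul_apply, averageMap_apply i hf, averageMap_apply i hg',
      averageMap_apply i (rectMax_add_smul_lt_top h hf hg t), smul_eq_mul]
    refine (θ.enorm_average_sub_sub_le i h hc hct x).trans ?_
    rw [mul_comm ε, ENNReal.ofReal_mul (abs_nonneg t)]
    gcongr
    calc _ ≤ ENNReal.ofReal (ε / 3) + (ENNReal.ofReal (ε / 3) + ENNReal.ofReal (ε / 3)) := by
          gcongr
      _ = _ := by
        rw [← ENNReal.ofReal_add (by positivity) (by positivity),
          ← ENNReal.ofReal_add (by positivity) (by positivity)]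
        congr 1; ring
  rw [← ofReal_norm, ENNReal.ofReal_le_ofReal_iff (by positivity)] at key
  simpa using key

/-! ### Bounds in `L^p` and almost everywhere regularity -/

theorem one_lt_toReal_of_one_lt {p : ℝ≥0∞} (hp : 1 < p) (hp' : p < ⊤) : 1 < p.toReal := by
  have := (ENNReal.toReal_lt_toReal ENNReal.one_ne_top hp'.ne).2 hp
  simpa using this

theorem eLpNorm_rpow_toReal {α : Type*} [MeasurableSpace α] {μ : Measure α} {p : ℝ≥0∞}
    (hp : 1 < p) (hp' : p < ⊤) (u : α → ℝ≥0∞) :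
    eLpNorm u p μ ^ p.toReal = ∫⁻ x, u x ^ p.toReal ∂μ := by
  have h := one_lt_toReal_of_one_lt hp hp'
  rw [eLpNorm_eq_lintegral_rpow_enorm_toReal (by positivity) hp'.ne, ← ENNReal.rpow_mul,
    one_div, inv_mul_cancel₀ (by linarith), ENNReal.rpow_one]
  rfl

theorem eLpNorm_le_of_lintegral_rpow_le {α : Type*} [MeasurableSpace α] {μ : Measure α} {p : ℝ≥0∞}
    (hp : 1 < p) (hp' : p < ⊤) {u v : α → ℝ≥0∞} {C : ℝ≥0∞}
    (h : ∫⁻ x, u x ^ p.toReal ∂μ ≤ C * ∫⁻ x, v x ^ p.toReal ∂μ) :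
    eLpNorm u p μ ≤ C ^ (p.toReal⁻¹) * eLpNorm v p μ := by
  have h1 := one_lt_toReal_of_one_lt hp hp'
  rw [← ENNReal.rpow_le_rpow_iff (show 0 < p.toReal by linarith),
    ENNReal.mul_rpow_of_nonneg _ _ (by linarith), eLpNorm_rpow_toReal hp hp',
    eLpNorm_rpow_toReal hp hp', ← ENNReal.rpow_mul, inv_mul_cancel₀ (by linarith), ENNReal.rpow_one]
  exact h

theorem exists_eLpNorm_rectMax_le (d : ℕ) {p : ℝ≥0∞} (hp : 1 < p) (hp' : p < ⊤) :
    ∃ C : ℝ≥0, ∀ f : EuclideanSpace ℝ (Fin d) → ℝ, AEStronglyMeasurable f →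
      eLpNorm (rectMax fun y => ‖f y‖ₑ) p volume ≤ C * eLpNorm f p volume := by
  have h1 := one_lt_toReal_of_one_lt hp hp'
  set A : ℝ := p.toReal * 8 * (p.toReal - 1)⁻¹ * 2 ^ (p.toReal - 1)
  refine ⟨((ENNReal.ofReal A ^ d) ^ (p.toReal⁻¹)).toNNReal, fun f hf => ?_⟩
  rw [ENNReal.coe_toNNReal (ENNReal.rpow_ne_top_of_nonneg (by positivity)
    (ENNReal.pow_ne_top ENNReal.ofReal_ne_top)), ← eLpNorm_enorm f]
  exact eLpNorm_le_of_lintegral_rpow_le hp hp' (lintegral_rectMax_rpow_le h1 hf.enorm)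

theorem exists_eLpNorm_lineMax_le (d : ℕ) {p : ℝ≥0∞} (hp : 1 < p) (hp' : p < ⊤) :
    ∃ C : ℝ≥0, ∀ (l : Fin d) (u : EuclideanSpace ℝ (Fin d) → ℝ≥0∞), Measurable u →
      eLpNorm (lineMax l u) p volume ≤ C * eLpNorm u p volume := by
  have h1 := one_lt_toReal_of_one_lt hp hp'
  set A : ℝ := p.toReal * 8 * (p.toReal - 1)⁻¹ * 2 ^ (p.toReal - 1)
  refine ⟨((ENNReal.ofReal A) ^ (p.toReal⁻¹)).toNNReal, fun l u hu => ?_⟩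
  rw [ENNReal.coe_toNNReal (ENNReal.rpow_ne_top_of_nonneg (by positivity) ENNReal.ofReal_ne_top)]
  exact eLpNorm_le_of_lintegral_rpow_le hp hp' (lintegral_lineMax_rpow_le l hu h1)

theorem ae_lt_top_of_eLpNorm_lt_top {α : Type*} [MeasurableSpace α] {μ : Measure α} {p : ℝ≥0∞}
    (hp : 1 < p) (hp' : p < ⊤) {u : α → ℝ≥0∞} (hu : Measurable u) (h : eLpNorm u p μ < ⊤) :
    ∀ᵐ x ∂μ, u x < ⊤ := by
  have h1 := one_lt_toReal_of_one_lt hp hp'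
  have h2 : ∫⁻ x, u x ^ p.toReal ∂μ ≠ ⊤ := by
    rw [← eLpNorm_rpow_toReal hp hp']
    exact ENNReal.rpow_ne_top_of_nonneg (by linarith) h.ne
  filter_upwards [ae_lt_top (hu.pow_const _) h2] with x hx
  by_contra hcon
  rw [not_lt, top_le_iff] at hcon
  rw [hcon, ENNReal.top_rpow_of_pos (by linarith)] at hx
  exact lt_irrefl _ hx

section Summable

variable {α : Type*} [MeasurableSpace α] {μ : Measure α} {p : ℝ≥0∞} {u : ℕ → α → ℝ≥0∞} {K : ℝ≥0∞}

/-- Geometric decay of the norms makes the sum of the `p`-th powers integrable. This yields both the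
almost everywhere convergence to `0` and the integrability of the supremum needed below. -/
theorem lintegral_tsum_rpow_lt_top (hp : 1 < p) (hp' : p < ⊤)
    (hu : ∀ n, Measurable (u n)) (hK : K < ⊤) (h : ∀ n, eLpNorm (u n) p μ ≤ K * 2⁻¹ ^ n) :
    ∫⁻ x, ∑' n, u n x ^ p.toReal ∂μ < ⊤ := by
  have h1 := one_lt_toReal_of_one_lt hp hp'
  rw [lintegral_tsum fun n => ((hu n).pow_const _).aemeasurable]
  have h2 (n : ℕ) : ∫⁻ x, u n x ^ p.toReal ∂μ ≤ K ^ p.toReal * (2⁻¹ : ℝ≥0∞) ^ n := by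
    rw [← eLpNorm_rpow_toReal hp hp']
    refine (ENNReal.rpow_le_rpow (h n) (by linarith)).trans ?_
    rw [ENNReal.mul_rpow_of_nonneg _ _ (by linarith)]
    gcongr
    have h3 : ((2⁻¹ : ℝ≥0∞) ^ n) ≤ 1 := pow_le_one₀ zero_le (by simp)
    exact ENNReal.rpow_le_self_of_le_one h3 h1.le
  refine (ENNReal.tsum_le_tsum h2).trans_lt ?_
  rw [ENNReal.tsum_mul_left, ENNReal.tsum_geometric]
  refine ENNReal.mul_lt_top (ENNReal.rpow_lt_top_of_nonneg (by linarith) hK.ne) ?_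
  simp

theorem ae_tendsto_zero_of_eLpNorm_le (hp : 1 < p) (hp' : p < ⊤)
    (hu : ∀ n, Measurable (u n)) (hK : K < ⊤) (h : ∀ n, eLpNorm (u n) p μ ≤ K * 2⁻¹ ^ n) :
    ∀ᵐ x ∂μ, Tendsto (fun n => u n x) atTop (𝓝 0) := by
  have h1 := one_lt_toReal_of_one_lt hp hp'
  have h2 := lintegral_tsum_rpow_lt_top hp hp' hu hK h
  filter_upwards [ae_lt_top (Measurable.tsum fun n => (hu n).pow_const _) h2.ne] with x hx
  have h3 := ENNReal.tendsto_atTop_zero_of_tsum_ne_top hx.ne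
  have h4 := h3.ennrpow_const (p.toReal⁻¹)
  rw [ENNReal.zero_rpow_of_pos (by positivity)] at h4
  refine h4.congr fun n => ?_
  rw [← ENNReal.rpow_mul, mul_inv_cancel₀ (by linarith), ENNReal.rpow_one]

theorem eLpNorm_iSup_lt_top (hp : 1 < p) (hp' : p < ⊤)
    (hu : ∀ n, Measurable (u n)) (hK : K < ⊤) (h : ∀ n, eLpNorm (u n) p μ ≤ K * 2⁻¹ ^ n) :
    eLpNorm (fun x => ⨆ n, u n x) p μ < ⊤ := by
  have h1 := one_lt_toReal_of_one_lt hp hp'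
  have h2 := lintegral_tsum_rpow_lt_top hp hp' hu hK h
  have h3 : eLpNorm (fun x => ⨆ n, u n x) p μ ^ p.toReal < ⊤ := by
    rw [eLpNorm_rpow_toReal hp hp']
    refine lt_of_le_of_lt (lintegral_mono fun x => ?_) h2
    rw [← ENNReal.le_rpow_inv_iff (by linarith)]
    refine iSup_le fun n => ?_
    rw [ENNReal.le_rpow_inv_iff (by linarith)]
    exact ENNReal.le_tsum (f := fun n => u n x ^ p.toReal) n
  by_contra hcon
  rw [not_lt, top_le_iff] at hcon
  rw [hcon, ENNReal.top_rpow_of_pos (by linarith)] at h3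
  exact lt_irrefl _ h3

end Summable

theorem eLpNorm_prod_le {α : Type*} [MeasurableSpace α] {μ : Measure α} {m : ℕ}
    {P : Fin m → ℝ≥0∞} {p : ℝ≥0∞} (hP : ∀ i, 1 < P i ∧ P i < ⊤) (hp : 1 < p ∧ p < ⊤)
    (hPp : 1 / p = ∑ i, 1 / P i) {u : Fin m → α → ℝ≥0∞} (hu : ∀ i, AEMeasurable (u i) μ) :
    eLpNorm (fun x => ∏ i, u i x) p μ ≤ ∏ i, eLpNorm (u i) (P i) μ := by
  have h1 := one_lt_toReal_of_one_lt hp.1 hp.2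
  have h2 (i : Fin m) := one_lt_toReal_of_one_lt (hP i).1 (hP i).2
  have hsum : ∑ i, p.toReal / (P i).toReal = 1 := by
    have h3 := congrArg ENNReal.toReal hPp
    rw [ENNReal.toReal_sum fun i _ => by
      simpa using (zero_lt_one.trans (hP i).1).ne'] at h3
    simp only [one_div, ENNReal.toReal_inv] at h3
    simp_rw [div_eq_mul_inv, ← Finset.mul_sum, ← h3]
    exact mul_inv_cancel₀ (by linarith)
  rw [← ENNReal.rpow_le_rpow_iff (show 0 < p.toReal by linarith), eLpNorm_rpow_toReal hp.1 hp.2]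
  have h4 := ENNReal.lintegral_prod_norm_pow_le (μ := μ) Finset.univ
    (f := fun i x => u i x ^ (P i).toReal) (fun i _ => (hu i).pow_const _) hsum
    (fun i _ => by positivity)
  rw [← ENNReal.prod_rpow_of_nonneg (by linarith)]
  refine (le_of_eq (lintegral_congr fun x => ?_)).trans (h4.trans (le_of_eq ?_))
  · rw [← ENNReal.prod_rpow_of_nonneg (by linarith)]
    refine Finset.prod_congr rfl fun i _ => ?_
    rw [← ENNReal.rpow_mul, mul_div_cancel₀ _ (by linarith [h2 i])]
  · refine Finset.prod_congr rfl fun i _ => ?_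
    rw [← eLpNorm_rpow_toReal (hP i).1 (hP i).2, ← ENNReal.rpow_mul,
      mul_div_cancel₀ _ (by linarith [h2 i])]

/-- Compactly supported continuous approximants at distance `2⁻¹ ^ n` have errors whose maximal
functions decay geometrically in norm, hence tend to `0` at almost every point. -/
theorem ae_isApproximable (l : Fin d) {g : EuclideanSpace ℝ (Fin d) → ℝ} {p : ℝ≥0∞} (hp : 1 < p)
    (hp' : p < ⊤) (hg : MemLp g p volume) : ∀ᵐ x, IsApproximable l g x := by
  have hex (n : ℕ) := hg.exists_hasCompactSupport_eLpNorm_sub_le hp'.ne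
    (ε := (2⁻¹ : ℝ≥0∞) ^ n) (pow_ne_zero _ (by simp))
  choose c hcc hgc hc hcp using hex
  obtain ⟨C, hC⟩ := exists_eLpNorm_rectMax_le d hp hp'
  obtain ⟨C', hC'⟩ := exists_eLpNorm_lineMax_le d hp hp'
  have h1 (n : ℕ) : eLpNorm (rectMax fun y => ‖(g - c n) y‖ₑ) p volume ≤ C * 2⁻¹ ^ n :=
    (hC _ (hg.sub (hcp n)).1).trans (by gcongr; exact hgc n)
  have h2 (n : ℕ) : eLpNorm (lineMax l (rectMax fun y => ‖(g - c n) y‖ₑ)) p volume ≤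
      (C' * C) * 2⁻¹ ^ n :=
    (hC' l _ (measurable_rectMax _)).trans (by rw [mul_assoc]; gcongr; exact h1 n)
  filter_upwards [ae_tendsto_zero_of_eLpNorm_le hp hp' (fun n => measurable_rectMax _)
    ENNReal.coe_lt_top h1, ae_tendsto_zero_of_eLpNorm_le hp hp'
    (fun n => measurable_lineMax l (measurable_rectMax _))
    (ENNReal.mul_lt_top ENNReal.coe_lt_top ENNReal.coe_lt_top) h2] with x hx1 hx2
  intro ε hε
  obtain ⟨n, hn1, hn2⟩ := ((hx1.eventually_le_const (ENNReal.ofReal_pos.2 hε)).and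
    (hx2.eventually_le_const (ENNReal.ofReal_pos.2 hε))).exists
  exact ⟨c n, hc n, hcc n, hn1, hn2⟩

/-- The maximal functions of `f` and of its derivative `g` in direction `l` are finite at `x`, and
`g` is approximable at `x`. -/
structure IsRegularPoint (l : Fin d) (f g : EuclideanSpace ℝ (Fin d) → ℝ)
    (x : EuclideanSpace ℝ (Fin d)) : Prop where
  rectMax_lt_top : rectMax (fun y => ‖f y‖ₑ) x < ⊤
  rectMax_deriv_lt_top : rectMax (fun y => ‖g y‖ₑ) x < ⊤
  lineMax_lt_top : lineMax l (rectMax fun y => ‖g y‖ₑ) x < ⊤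
  isApproximable : IsApproximable l g x

theorem MeasureTheory.MemLp.eLpNorm_rectMax_lt_top {g : EuclideanSpace ℝ (Fin d) → ℝ} {p : ℝ≥0∞}
    (hg : MemLp g p volume) (hp : 1 < p) (hp' : p < ⊤) :
    eLpNorm (rectMax fun y => ‖g y‖ₑ) p volume < ⊤ := by
  obtain ⟨C, hC⟩ := exists_eLpNorm_rectMax_le d hp hp'
  exact (hC g hg.1).trans_lt (ENNReal.mul_lt_top ENNReal.coe_lt_top hg.2)

theorem MeasureTheory.MemLp.eLpNorm_lineMax_rectMax_lt_top {g : EuclideanSpace ℝ (Fin d) → ℝ}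
    {p : ℝ≥0∞} (hg : MemLp g p volume) (l : Fin d) (hp : 1 < p) (hp' : p < ⊤) :
    eLpNorm (lineMax l (rectMax fun y => ‖g y‖ₑ)) p volume < ⊤ := by
  obtain ⟨C, hC⟩ := exists_eLpNorm_lineMax_le d hp hp'
  exact (hC l _ (measurable_rectMax _)).trans_lt
    (ENNReal.mul_lt_top ENNReal.coe_lt_top (hg.eLpNorm_rectMax_lt_top hp hp'))

theorem ae_isRegularPoint (l : Fin d) {f g : EuclideanSpace ℝ (Fin d) → ℝ} {p : ℝ≥0∞}
    (hp : 1 < p) (hp' : p < ⊤) (hf : MemLp f p volume) (hg : MemLp g p volume) :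
    ∀ᵐ x, IsRegularPoint l f g x := by
  filter_upwards [ae_isApproximable l hp hp' hg,
    ae_lt_top_of_eLpNorm_lt_top hp hp' (measurable_rectMax _) (hf.eLpNorm_rectMax_lt_top hp hp'),
    ae_lt_top_of_eLpNorm_lt_top hp hp' (measurable_rectMax _) (hg.eLpNorm_rectMax_lt_top hp hp'),
    ae_lt_top_of_eLpNorm_lt_top hp hp' (measurable_lineMax l (measurable_rectMax _))
      (hg.eLpNorm_lineMax_rectMax_lt_top l hp hp')] with x h1 h2 h3 h4
  exact ⟨h2, h3, h4, h1⟩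

/-! ### One-sided derivatives of a norm along a curve -/

section NormAlongCurves

variable {E : Type*} [NormedAddCommGroup E] [NormedSpace ℝ E]

/-- The norm is `1`-Lipschitz, so a curve may be replaced by its tangent line up to `o(t)`; on the
line, convexity provides the one-sided derivatives. -/
theorem HasDerivAt.hasDerivWithinAt_norm {z : ℝ → E} {z' : E} (hz : HasDerivAt z z' 0) {D : ℝ}
    {s : Set ℝ} (h : HasDerivWithinAt (fun t : ℝ => ‖z 0 + t • z'‖) D s 0) :
    HasDerivWithinAt (fun t => ‖z t‖) D s 0 := by
  rw [hasDerivWithinAt_iff_isLittleO] at h ⊢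
  have h1 := (hasDerivAt_iff_isLittleO.1 hz).mono (nhdsWithin_le_nhds (s := s))
  have h2 : (fun t => ‖z t‖ - ‖z 0 + t • z'‖) =o[𝓝[s] 0] fun t => t - 0 := by
    refine Asymptotics.IsBigO.trans_isLittleO (Asymptotics.IsBigO.of_bound 1
      (Eventually.of_forall fun t => ?_)) h1
    rw [one_mul, Real.norm_eq_abs]
    refine (abs_norm_sub_norm_le _ _).trans (le_of_eq ?_)
    rw [sub_zero]; congr 1; abel
  refine (h.add h2).congr_left fun t => ?_
  simp only [zero_smul, add_zero]
  ring

theorem convexOn_norm_add_smul (a b : E) : ConvexOn ℝ univ fun t : ℝ => ‖a + t • b‖ := by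
  have h := (convexOn_norm (E := E) convex_univ).comp_affineMap
    (AffineMap.lineMap a (a + b) : ℝ →ᵃ[ℝ] E)
  refine h.congr fun t _ => ?_
  simp [AffineMap.lineMap_apply, add_comm]

theorem hasDerivWithinAt_Ioi_norm_add_smul (a b : E) :
    HasDerivWithinAt (fun t : ℝ => ‖a + t • b‖)
      (derivWithin (fun t : ℝ => ‖a + t • b‖) (Ioi 0) 0) (Ioi 0) 0 :=
  (convexOn_norm_add_smul a b).hasDerivWithinAt_rightDeriv_of_mem_interior (by simp)

theorem hasDerivWithinAt_Iio_norm_add_smul (a b : E) :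
    HasDerivWithinAt (fun t : ℝ => ‖a + t • b‖)
      (derivWithin (fun t : ℝ => ‖a + t • b‖) (Iio 0) 0) (Iio 0) 0 :=
  (convexOn_norm_add_smul a b).hasDerivWithinAt_leftDeriv_of_mem_interior (by simp)

theorem HasDerivAt.enorm_le_of_norm_add_smul {a b : E} {D : ℝ}
    (h : HasDerivAt (fun t : ℝ => ‖a + t • b‖) D 0) : ‖D‖ₑ ≤ ‖b‖ₑ := by
  rw [← ofReal_norm, ← ofReal_norm]
  refine ENNReal.ofReal_le_ofReal (h.le_of_lip' (norm_nonneg b) (Eventually.of_forall fun t => ?_))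
  rw [Real.norm_eq_abs]
  refine (abs_norm_sub_norm_le _ _).trans (le_of_eq ?_)
  rw [add_sub_add_left_eq_sub, ← sub_smul, norm_smul, mul_comm]

/-- Pointwise convergence of convex functions entails convergence of their derivatives. -/
theorem tendsto_deriv_of_convexOn {φ : ℕ → ℝ → ℝ} {ψ : ℝ → ℝ} (hφ : ∀ n, ConvexOn ℝ univ (φ n))
    {D : ℕ → ℝ} {D' : ℝ} (hD : ∀ n, HasDerivAt (φ n) (D n) 0) (hD' : HasDerivAt ψ D' 0)
    (hlim : ∀ t, Tendsto (fun n => φ n t) atTop (𝓝 (ψ t))) : Tendsto D atTop (𝓝 D') := by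
  have hslope (t : ℝ) : Tendsto (fun n => slope (φ n) 0 t) atTop (𝓝 (slope ψ 0 t)) := by
    simp only [slope_def_field]
    exact ((hlim t).sub (hlim 0)).div_const _
  have hsl := hasDerivAt_iff_tendsto_slope.1 hD'
  -- The derivative at `0` of a convex function lies between its slopes to the left and to the right
  -- of `0`. A fixed `t` with slope of `ψ` beyond `a` is chosen first, and slopes at fixed `t`
  -- converge.
  refine tendsto_order.2 ⟨fun a ha => ?_, fun a ha => ?_⟩
  · have h1 := (hsl.mono_left (nhdsWithin_mono 0
      (s := Iio 0) fun t ht => ne_of_lt ht)).eventually_const_lt ha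
    obtain ⟨t, ht, ht0⟩ := (h1.and self_mem_nhdsWithin).exists
    filter_upwards [(hslope t).eventually_const_lt ht] with n hn
    refine hn.trans_le ?_
    rw [slope_comm]
    exact (hφ n).slope_le_of_hasDerivAt (mem_univ _) (mem_univ _) ht0 (hD n)
  · have h1 := (hsl.mono_left (nhdsWithin_mono 0
      (s := Ioi 0) fun t ht => ne_of_gt ht)).eventually_lt_const ha
    obtain ⟨t, ht, ht0⟩ := (h1.and self_mem_nhdsWithin).exists
    filter_upwards [(hslope t).eventually_lt_const ht] with n hn
    exact ((hφ n).le_slope_of_hasDerivAt (mem_univ _) (mem_univ _) ht0 (hD n)).trans_lt hn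

end NormAlongCurves

/-! ### The weak derivative of the maximal function -/

/-- Integration by parts for a function with one-sided directional derivatives and dominated
difference quotients. -/
theorem integral_mul_eq_neg_of_tendsto {F H D : EuclideanSpace ℝ (Fin d) → ℝ}
    (hF : LocallyIntegrable F) (hH : LocallyIntegrable H) {v : EuclideanSpace ℝ (Fin d)}
    (hdom : ∀ᵐ x, ∀ t : ℝ, 0 < t → t ≤ 1 → |F (x + t • v) - F x| ≤ t * H x)
    (hD : ∀ᵐ x, Tendsto (fun t : ℝ => t⁻¹ * (F (x + t • v) - F x)) (𝓝[>] 0) (𝓝 (D x))) :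
    LocallyIntegrable D ∧ ∀ φ : EuclideanSpace ℝ (Fin d) → ℝ, ContDiff ℝ ∞ φ → HasCompactSupport φ →
      ∫ x, F x * fderiv ℝ φ x v = -∫ x, D x * φ x := by
  have hmeas (t : ℝ) : AEStronglyMeasurable fun x => t⁻¹ * (F (x + t • v) - F x) :=
    ((locallyIntegrable_comp_add_right hF (t • v)).aestronglyMeasurable.sub
      hF.aestronglyMeasurable).const_mul _
  have hsmall : ∀ᶠ t : ℝ in 𝓝[>] 0, t ≤ 1 :=
    nhdsWithin_le_nhds (eventually_le_nhds zero_lt_one)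
  have hdom' : ∀ᶠ t : ℝ in 𝓝[>] 0, ∀ᵐ x, |t⁻¹ * (F (x + t • v) - F x)| ≤ H x := by
    filter_upwards [self_mem_nhdsWithin, hsmall] with t ht ht1
    have ht' : 0 < t := ht
    filter_upwards [hdom] with x hx
    rw [abs_mul, abs_inv, abs_of_pos ht', inv_mul_le_iff₀ ht']
    exact hx t ht' ht1
  have hDH : ∀ᵐ x, |D x| ≤ H x := by
    filter_upwards [hD, hdom] with x hx hdx
    refine le_of_tendsto hx.abs ?_
    filter_upwards [self_mem_nhdsWithin, hsmall] with t ht ht1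
    have ht' : 0 < t := ht
    rw [abs_mul, abs_inv, abs_of_pos ht', inv_mul_le_iff₀ ht']
    exact hdx t ht' ht1
  have hDm : AEStronglyMeasurable D := aestronglyMeasurable_of_tendsto_ae (𝓝[>] (0 : ℝ)) hmeas hD
  refine ⟨hH.mono hDm (by
    filter_upwards [hDH] with x hx
    exact hx.trans (le_abs_self _)), fun φ hφ hc => ?_⟩
  obtain ⟨B, r, hB, hr⟩ := exists_bound_of_hasCompactSupport hφ.continuous hc
  obtain ⟨L, hL⟩ := hφ.lipschitzWith_of_hasCompactSupport hc (by simp)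
  have h1 : Tendsto (fun t : ℝ => ∫ x, t⁻¹ * (F (x + t • v) - F x) * φ x) (𝓝[>] 0)
      (𝓝 (∫ x, D x * φ x)) := by
    refine tendsto_integral_filter_of_dominated_convergence (fun x => |H x * φ x|)
      (Eventually.of_forall fun t => (hmeas t).mul hφ.continuous.aestronglyMeasurable) ?_
      (integrable_mul_of_bounded hH hφ.continuous.aestronglyMeasurable hB hr).abs ?_
    · filter_upwards [hdom'] with t ht
      filter_upwards [ht] with x hx
      rw [norm_mul, Real.norm_eq_abs, Real.norm_eq_abs, abs_mul (H x)]
      exact mul_le_mul_of_nonneg_right (hx.trans (le_abs_self _)) (abs_nonneg _)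
    · filter_upwards [hD] with x hx using hx.mul_const _
  -- `F` is only locally integrable and must be cut off. The radius `r + ‖v‖` leaves the products
  -- with `φ` and with its translates by `-(t • v)`, `0 < t ≤ 1`, unchanged. The direction is `-v`
  -- because the translation is moved from `F` to `φ`.
  set K := Metric.closedBall (0 : EuclideanSpace ℝ (Fin d)) (r + ‖v‖)
  have hK : Integrable (K.indicator F) :=
    (hF.integrableOn_isCompact (isCompact_closedBall _ _)).integrable_indicator
      Metric.isClosed_closedBall.measurableSet
  have h2 := LipschitzWith.integral_inv_smul_sub_mul_tendsto_integral_lineDeriv_mul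
    (μ := volume) hL hK (-v)
  have hout (z : EuclideanSpace ℝ (Fin d)) (hz : z ∉ K) (w : EuclideanSpace ℝ (Fin d))
      (hw : ‖w‖ ≤ ‖v‖) : φ (z + w) = 0 := by
    refine hr _ fun hmem => hz ?_
    rw [mem_closedBall_zero_iff] at hmem ⊢
    calc ‖z‖ = ‖(z + w) - w‖ := by rw [add_sub_cancel_right]
      _ ≤ ‖z + w‖ + ‖w‖ := norm_sub_le _ _
      _ ≤ _ := by gcongr
  have h3 : Tendsto (fun t : ℝ => ∫ x, t⁻¹ * (F (x + t • v) - F x) * φ x) (𝓝[>] 0)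
      (𝓝 (∫ x, lineDeriv ℝ φ x (-v) * K.indicator F x)) := by
    refine h2.congr' ?_
    filter_upwards [self_mem_nhdsWithin, hsmall] with t ht ht1
    have ht' : 0 < t := ht
    have i1 : Integrable fun x => F x * φ x :=
      integrable_mul_of_bounded hF hφ.continuous.aestronglyMeasurable hB hr
    have i2 : Integrable fun x => F (x + t • v) * φ x :=
      integrable_mul_of_bounded (locallyIntegrable_comp_add_right hF _)
        hφ.continuous.aestronglyMeasurable hB hr
    have i3 : Integrable fun x => F x * φ (x - t • v) := by
      have := i2.comp_add_right (-(t • v))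
      simpa [sub_eq_add_neg] using this
    have hshift : ∫ x, F (x + t • v) * φ x = ∫ x, F x * φ (x - t • v) := by
      have := integral_add_right_eq_self (μ := volume) (fun z => F z * φ (z - t • v)) (t • v)
      simpa using this
    have e1 : ∫ x, t⁻¹ * (F (x + t • v) - F x) * φ x =
        t⁻¹ * ∫ x, F x * (φ (x - t • v) - φ x) := by
      simp_rw [mul_assoc]
      rw [integral_const_mul]
      congr 1
      simp_rw [sub_mul, mul_sub]
      rw [integral_sub i2 i1, integral_sub i3 i1, hshift]
    rw [e1, ← integral_const_mul]
    refine integral_congr_ae (ae_of_all _ fun x => ?_)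
    simp only [smul_neg, smul_eq_mul, ← sub_eq_add_neg]
    by_cases hx : x ∈ K
    · rw [indicator_of_mem hx]; ring
    · have e2 := hout x hx 0 (by simp)
      have e3 := hout x hx (-(t • v)) (by
        rw [norm_neg, norm_smul, Real.norm_of_nonneg ht'.le]
        exact mul_le_of_le_one_left (norm_nonneg _) ht1)
      rw [add_zero] at e2
      rw [← sub_eq_add_neg] at e3
      simp [e2, e3]
  have h4 := tendsto_nhds_unique h1 h3
  rw [h4, ← integral_neg]
  refine integral_congr_ae (ae_of_all _ fun x => ?_)
  have hdiff := hφ.differentiable (by simp) x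
  simp only [hdiff.lineDeriv_eq_fderiv, map_neg]
  by_cases hx : x ∈ K
  · rw [indicator_of_mem hx]; ring
  · have hzero : fderiv ℝ φ x v = 0 := by
      have hball : tsupport φ ⊆ Metric.closedBall (0 : EuclideanSpace ℝ (Fin d)) r :=
        closure_minimal (fun z hz => by
          by_contra hcon
          exact hz (hr z hcon)) Metric.isClosed_closedBall
      rw [fderiv_of_notMem_tsupport ℝ fun hsub => hx
        (Metric.closedBall_subset_closedBall (by linarith [norm_nonneg v]) (hball hsub))]
      rfl
    simp [hzero]

theorem enorm_prod_sub_prod_le {ι : Type*} (s : Finset ι) {a b : ι → ℝ} {B : ι → ℝ≥0∞} {ε : ℝ≥0∞}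
    (ha : ∀ i, ‖a i‖ₑ ≤ B i) (hb : ∀ i, ‖b i‖ₑ ≤ B i) (hab : ∀ i, ‖a i - b i‖ₑ ≤ ε * B i) :
    ‖∏ i ∈ s, a i - ∏ i ∈ s, b i‖ₑ ≤ ε * (s.card * ∏ i ∈ s, B i) := by
  classical
  induction s using Finset.induction_on with
  | empty => simp
  | insert j s hj ih =>
    rw [Finset.prod_insert hj, Finset.prod_insert hj, Finset.prod_insert hj,
      Finset.card_insert_of_notMem hj]
    have h1 : a j * ∏ i ∈ s, a i - b j * ∏ i ∈ s, b i =
        (a j - b j) * ∏ i ∈ s, a i + b j * (∏ i ∈ s, a i - ∏ i ∈ s, b i) := by ring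
    have h2 : ‖∏ i ∈ s, a i‖ₑ ≤ ∏ i ∈ s, B i := by
      rw [← ofReal_norm, norm_prod, ENNReal.ofReal_prod_of_nonneg fun _ _ => norm_nonneg _]
      exact Finset.prod_le_prod' fun i _ => by rw [ofReal_norm]; exact ha i
    rw [h1]
    calc _ ≤ ‖(a j - b j) * ∏ i ∈ s, a i‖ₑ + ‖b j * (∏ i ∈ s, a i - ∏ i ∈ s, b i)‖ₑ :=
          enorm_add_le _ _
      _ ≤ (ε * B j) * (∏ i ∈ s, B i) + B j * (ε * (s.card * ∏ i ∈ s, B i)) := by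
          rw [enorm_mul, enorm_mul]
          gcongr
          · exact hab j
          · exact hb j
      _ = _ := by push_cast; ring

theorem BoundedContinuousFunction.enorm_add_le {α : Type*} [TopologicalSpace α] (u v : α →ᵇ ℝ) :
    ‖u + v‖ₑ ≤ ‖u‖ₑ + ‖v‖ₑ := by
  rw [← ofReal_norm, ← ofReal_norm, ← ofReal_norm, ← ENNReal.ofReal_add (norm_nonneg _)
    (norm_nonneg _)]
  exact ENNReal.ofReal_le_ofReal (norm_add_le u v)

theorem BoundedContinuousFunction.enorm_sum_le {α ι : Type*} [TopologicalSpace α] (s : Finset ι)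
    (u : ι → α →ᵇ ℝ) : ‖∑ i ∈ s, u i‖ₑ ≤ ∑ i ∈ s, ‖u i‖ₑ := by
  rw [← ofReal_norm]
  refine (ENNReal.ofReal_le_ofReal (norm_sum_le s u)).trans (le_of_eq ?_)
  rw [ENNReal.ofReal_sum_of_nonneg fun _ _ => norm_nonneg _]
  simp_rw [ofReal_norm]

/-- The product of the averages of `f₁, …, f_m` around `x`. -/
noncomputable def productMap (f : Fin m → EuclideanSpace ℝ (Fin d) → ℝ)
    (x : EuclideanSpace ℝ (Fin d)) : KernelTuple d m →ᵇ ℝ :=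
  ∏ i, averageMap i (f i) x

/-- The derivative of `productMap f` when `g i` is the derivative of `f i`. -/
noncomputable def productMapDeriv (f g : Fin m → EuclideanSpace ℝ (Fin d) → ℝ)
    (x : EuclideanSpace ℝ (Fin d)) : KernelTuple d m →ᵇ ℝ :=
  ∑ μ, (∏ j ∈ Finset.univ.erase μ, averageMap j (f j) x) • averageMap μ (g μ) x

theorem hasDerivAt_productMap {l : Fin d} {f g : Fin m → EuclideanSpace ℝ (Fin d) → ℝ}
    (h : ∀ i, HasWeakPartial l (f i) (g i)) {x : EuclideanSpace ℝ (Fin d)}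
    (hx : ∀ i, IsRegularPoint l (f i) (g i) x) :
    HasDerivAt (fun t : ℝ => productMap f (x + t • EuclideanSpace.single l 1))
      (productMapDeriv f g x) 0 := by
  have := HasDerivAt.fun_finsetProd (u := Finset.univ) (x := (0 : ℝ))
    fun i _ => hasDerivAt_averageMap (m := m) i (h i) (hx i).rectMax_lt_top
      (hx i).rectMax_deriv_lt_top (hx i).lineMax_lt_top (hx i).isApproximable
  simpa [productMap, productMapDeriv] using this

/-- Each summand is again a product of averages, with `f μ` replaced by `g μ`, so its norm is itself
a multilinear maximal function. -/
theorem enorm_productMapDeriv_le {f g : Fin m → EuclideanSpace ℝ (Fin d) → ℝ}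
    (hf : ∀ i, LocallyIntegrable (f i)) (hg : ∀ i, LocallyIntegrable (g i))
    {x : EuclideanSpace ℝ (Fin d)} (hfx : ∀ i, rectMax (fun y => ‖f i y‖ₑ) x < ⊤)
    (hgx : ∀ i, rectMax (fun y => ‖g i y‖ₑ) x < ⊤) :
    ‖productMapDeriv f g x‖ₑ ≤ ∑ μ, strongMaximal (Function.update f μ (g μ)) x := by
  refine (BoundedContinuousFunction.enorm_sum_le _ _).trans (Finset.sum_le_sum fun μ _ => le_of_eq ?_)
  rw [← enorm_prod_averageMap (f := Function.update f μ (g μ))]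
  · rw [← Finset.prod_erase_mul _ _ (Finset.mem_univ μ), Function.update_self, smul_eq_mul]
    congr 2
    refine Finset.prod_congr rfl fun j hj => ?_
    rw [Function.update_of_ne (Finset.ne_of_mem_erase hj)]
  · intro i
    by_cases hi : i = μ
    · subst hi; simpa using hg i
    · simpa [hi] using hf i
  · intro i
    by_cases hi : i = μ
    · subst hi; simpa using hgx i
    · simpa [hi] using hfx i

/-- The telescoping estimate for products, with errors relative to the bounds `B i`; taking `ε =
|t|` yields a Lipschitz bound along lines. -/
theorem enorm_productMap_sub_le {f g : Fin m → EuclideanSpace ℝ (Fin d) → ℝ}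
    {x x' : EuclideanSpace ℝ (Fin d)} {B : Fin m → ℝ≥0∞} {ε : ℝ≥0∞}
    (hf : ∀ i, ‖(averageMap i (f i) x : KernelTuple d m →ᵇ ℝ)‖ₑ ≤ B i)
    (hg : ∀ i, ‖(averageMap i (g i) x' : KernelTuple d m →ᵇ ℝ)‖ₑ ≤ B i)
    (hfg : ∀ i, ‖(averageMap i (f i) x - averageMap i (g i) x' : KernelTuple d m →ᵇ ℝ)‖ₑ ≤ ε * B i) :
    ‖productMap f x - productMap g x'‖ₑ ≤ ε * (m * ∏ i, B i) := by
  refine BoundedContinuousFunction.enorm_le_of_forall fun θ => ?_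
  rw [BoundedContinuousFunction.sub_apply, productMap, productMap,
    BoundedContinuousFunction.prod_apply, BoundedContinuousFunction.prod_apply]
  have := enorm_prod_sub_prod_le Finset.univ (B := B) (ε := ε)
    (fun i => (BoundedContinuousFunction.enorm_coe_le _ θ).trans (hf i))
    (fun i => (BoundedContinuousFunction.enorm_coe_le _ θ).trans (hg i))
    (fun i => (BoundedContinuousFunction.enorm_coe_le _ θ).trans (hfg i))
  simpa using this

theorem exists_eLpNorm_strongMaximal_le (d : ℕ) {P : Fin m → ℝ≥0∞} {p : ℝ≥0∞}
    (hP : ∀ i, 1 < P i ∧ P i < ⊤) (hp : 1 < p ∧ p < ⊤) (hPp : 1 / p = ∑ i, 1 / P i) :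
    ∃ C : ℝ≥0, ∀ f : Fin m → EuclideanSpace ℝ (Fin d) → ℝ, (∀ i, AEStronglyMeasurable (f i)) →
      eLpNorm (strongMaximal f) p volume ≤ C * ∏ i, eLpNorm (f i) (P i) volume := by
  choose C hC using fun i => exists_eLpNorm_rectMax_le d (hP i).1 (hP i).2
  refine ⟨∏ i, C i, fun f hf => ?_⟩
  calc eLpNorm (strongMaximal f) p volume
      ≤ eLpNorm (fun x => ∏ i, rectMax (fun y => ‖f i y‖ₑ) x) p volume :=
        eLpNorm_mono_enorm fun x => strongMaximal_le_prod_rectMax f x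
    _ ≤ ∏ i, eLpNorm (rectMax fun y => ‖f i y‖ₑ) (P i) volume :=
        eLpNorm_prod_le hP hp hPp fun i => (measurable_rectMax _).aemeasurable
    _ ≤ ∏ i, C i * eLpNorm (f i) (P i) volume :=
        Finset.prod_le_prod' fun i _ => hC i (f i) (hf i)
    _ = _ := by rw [Finset.prod_mul_distrib]; push_cast; rfl

theorem eLpNorm_toReal_le {α : Type*} [MeasurableSpace α] {μ : Measure α} (u : α → ℝ≥0∞)
    (p : ℝ≥0∞) : eLpNorm (fun x => (u x).toReal) p μ ≤ eLpNorm u p μ :=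
  eLpNorm_mono_enorm fun x => by
    rw [Real.enorm_of_nonneg ENNReal.toReal_nonneg]; exact ENNReal.ofReal_toReal_le

theorem memLp_strongMaximalReal {P : Fin m → ℝ≥0∞} {p : ℝ≥0∞}
    (hP : ∀ i, 1 < P i ∧ P i < ⊤) (hp : 1 < p ∧ p < ⊤) (hPp : 1 / p = ∑ i, 1 / P i)
    {f : Fin m → EuclideanSpace ℝ (Fin d) → ℝ} (hf : ∀ i, MemLp (f i) (P i) volume) :
    MemLp (strongMaximalReal f) p volume := by
  obtain ⟨C, hC⟩ := exists_eLpNorm_strongMaximal_le d hP hp hPp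
  refine ⟨(measurable_strongMaximal f).ennreal_toReal.aestronglyMeasurable,
    (eLpNorm_toReal_le _ _).trans_lt ((hC f fun i => (hf i).1).trans_lt ?_)⟩
  exact ENNReal.mul_lt_top ENNReal.coe_lt_top (ENNReal.prod_lt_top fun i _ => (hf i).2)

theorem enorm_strongMaximalReal_sub_le {f g : Fin m → EuclideanSpace ℝ (Fin d) → ℝ}
    (hf : ∀ i, LocallyIntegrable (f i)) (hg : ∀ i, LocallyIntegrable (g i))
    {x x' : EuclideanSpace ℝ (Fin d)} (hfx : ∀ i, rectMax (fun y => ‖f i y‖ₑ) x < ⊤)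
    (hgx : ∀ i, rectMax (fun y => ‖g i y‖ₑ) x' < ⊤) :
    ‖strongMaximalReal f x - strongMaximalReal g x'‖ₑ ≤ ‖productMap f x - productMap g x'‖ₑ := by
  rw [strongMaximalReal_eq_norm hf hfx, strongMaximalReal_eq_norm hg hgx, ← ofReal_norm,
    ← ofReal_norm]
  exact ENNReal.ofReal_le_ofReal (abs_norm_sub_norm_le _ _)

theorem exists_hasWeakPartial_strongMaximalReal {P : Fin m → ℝ≥0∞} {p : ℝ≥0∞}
    (hP : ∀ i, 1 < P i ∧ P i < ⊤) (hp : 1 < p ∧ p < ⊤) (hPp : 1 / p = ∑ i, 1 / P i) {l : Fin d}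
    {f g : Fin m → EuclideanSpace ℝ (Fin d) → ℝ} (h : ∀ i, HasWeakPartial l (f i) (g i))
    (hf : ∀ i, MemLp (f i) (P i) volume) (hg : ∀ i, MemLp (g i) (P i) volume) :
    ∃ D, HasWeakPartial l (strongMaximalReal f) D ∧
      ∀ᵐ x, HasDerivAt (fun t : ℝ => ‖productMap f x + t • productMapDeriv f g x‖) (D x) 0 := by
  set e : EuclideanSpace ℝ (Fin d) := EuclideanSpace.single l 1 with he
  have hreg : ∀ᵐ x, ∀ i, IsRegularPoint l (f i) (g i) x :=
    ae_all_iff.2 fun i => ae_isRegularPoint l (hP i).1 (hP i).2 (hf i) (hg i)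
  -- For `|t| ≤ 1`, `B i x` bounds `averageMap i (f i)` at `x` and at `x + t • e`, and `|t| * B i x`
  -- bounds their difference. Hence `H`, with one factor `m` from telescoping, dominates the
  -- difference quotients.
  set B : Fin m → EuclideanSpace ℝ (Fin d) → ℝ≥0∞ := fun i x =>
    rectMax (fun y => ‖f i y‖ₑ) x + lineMax l (rectMax fun y => ‖g i y‖ₑ) x
  have hBm (i : Fin m) : Measurable (B i) :=
    (measurable_rectMax _).add (measurable_lineMax l (measurable_rectMax _))
  have hBp (i : Fin m) : eLpNorm (B i) (P i) volume < ⊤ :=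
    (eLpNorm_add_le (measurable_rectMax _).aestronglyMeasurable
      (measurable_lineMax l (measurable_rectMax _)).aestronglyMeasurable (hP i).1.le).trans_lt
    (ENNReal.add_lt_top.2 ⟨(hf i).eLpNorm_rectMax_lt_top (hP i).1 (hP i).2,
      (hg i).eLpNorm_lineMax_rectMax_lt_top l (hP i).1 (hP i).2⟩)
  set H : EuclideanSpace ℝ (Fin d) → ℝ := fun x => m * (∏ i, B i x).toReal
  have hH : LocallyIntegrable H := by
    have h1 : MemLp (fun x => (∏ i, B i x).toReal) p volume :=
      ⟨(Finset.measurable_prod _ fun i _ => hBm i).ennreal_toReal.aestronglyMeasurable,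
        (eLpNorm_toReal_le _ _).trans_lt
        ((eLpNorm_prod_le hP hp hPp fun i => (hBm i).aemeasurable).trans_lt
          (ENNReal.prod_lt_top fun i _ => hBp i))⟩
    exact (h1.const_mul _).locallyIntegrable hp.1.le
  have hF : LocallyIntegrable (strongMaximalReal f) :=
    (memLp_strongMaximalReal hP hp hPp hf).locallyIntegrable hp.1.le
  have hfl (i : Fin m) : LocallyIntegrable (f i) := (h i).1
  have hfin {x : EuclideanSpace ℝ (Fin d)} (hx : ∀ i, IsRegularPoint l (f i) (g i) x) (t : ℝ)
      (i : Fin m) : rectMax (fun y => ‖f i y‖ₑ) (x + t • e) < ⊤ :=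
    rectMax_add_smul_lt_top (h i) (hx i).rectMax_lt_top (hx i).lineMax_lt_top t
  have hdom {x : EuclideanSpace ℝ (Fin d)} (hx : ∀ i, IsRegularPoint l (f i) (g i) x) (t : ℝ)
      (ht : |t| ≤ 1) :
      |strongMaximalReal f (x + t • e) - strongMaximalReal f x| ≤ |t| * H x := by
    have h1 : ‖strongMaximalReal f (x + t • e) - strongMaximalReal f x‖ₑ ≤
        ENNReal.ofReal |t| * (m * ∏ i, B i x) := by
      refine (enorm_strongMaximalReal_sub_le hfl hfl (hfin hx t)
        fun i => (hx i).rectMax_lt_top).trans ?_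
      have h2 (i : Fin m) := enorm_averageMap_add_smul_sub_le (m := m) i (h i)
        (hx i).rectMax_lt_top (hx i).lineMax_lt_top t
      have h3 (i : Fin m) := enorm_averageMap_le (m := m) i (f i) x
      refine enorm_productMap_sub_le (fun i => ?_) (fun i => (h3 i).trans le_self_add)
        (fun i => (h2 i).trans (mul_le_mul_right le_add_self _))
      calc ‖(averageMap i (f i) (x + t • e) : KernelTuple d m →ᵇ ℝ)‖ₑ
          = ‖(averageMap i (f i) x + (averageMap i (f i) (x + t • e) - averageMap i (f i) x) :
            KernelTuple d m →ᵇ ℝ)‖ₑ := by rw [add_sub_cancel]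
        _ ≤ _ := (BoundedContinuousFunction.enorm_add_le _ _).trans (add_le_add (h3 i) ((h2 i).trans
          (mul_le_of_le_one_left' (by simpa using ht))))
    have hBfin : ∏ i, B i x ≠ ⊤ := ENNReal.prod_ne_top fun i _ =>
      (ENNReal.add_lt_top.2 ⟨(hx i).rectMax_lt_top, (hx i).lineMax_lt_top⟩).ne
    have h4 := ENNReal.toReal_mono (ENNReal.mul_ne_top ENNReal.ofReal_ne_top
      (ENNReal.mul_ne_top (ENNReal.natCast_ne_top m) hBfin)) h1
    rw [toReal_enorm, ENNReal.toReal_mul, ENNReal.toReal_mul,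
      ENNReal.toReal_ofReal (abs_nonneg t), ENNReal.toReal_natCast] at h4
    exact h4
  have hright : ∀ᵐ x, HasDerivWithinAt (fun t : ℝ => strongMaximalReal f (x + t • e))
      (derivWithin (fun t : ℝ => ‖productMap f x + t • productMapDeriv f g x‖) (Ioi 0) 0)
      (Ioi 0) 0 := by
    filter_upwards [hreg] with x hx
    simp_rw [strongMaximalReal_eq_norm hfl (hfin hx _)]
    refine (hasDerivAt_productMap h hx).hasDerivWithinAt_norm ?_
    simpa using hasDerivWithinAt_Ioi_norm_add_smul (productMap f x) (productMapDeriv f g x)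
  have hleft : ∀ᵐ x, HasDerivWithinAt (fun t : ℝ => strongMaximalReal f (x + t • e))
      (derivWithin (fun t : ℝ => ‖productMap f x + t • productMapDeriv f g x‖) (Iio 0) 0)
      (Iio 0) 0 := by
    filter_upwards [hreg] with x hx
    simp_rw [strongMaximalReal_eq_norm hfl (hfin hx _)]
    refine (hasDerivAt_productMap h hx).hasDerivWithinAt_norm ?_
    simpa using hasDerivWithinAt_Iio_norm_add_smul (productMap f x) (productMapDeriv f g x)
  set Dr : EuclideanSpace ℝ (Fin d) → ℝ := fun x =>
    derivWithin (fun t : ℝ => ‖productMap f x + t • productMapDeriv f g x‖) (Ioi 0) 0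
  set Dl : EuclideanSpace ℝ (Fin d) → ℝ := fun x =>
    derivWithin (fun t : ℝ => ‖productMap f x + t • productMapDeriv f g x‖) (Iio 0) 0
  have hr := integral_mul_eq_neg_of_tendsto hF hH (v := e) (D := Dr)
    (by
      filter_upwards [hreg] with x hx t ht ht1
      have := hdom hx t (by rwa [abs_of_pos ht])
      rwa [abs_of_pos ht] at this)
    (by
      filter_upwards [hright] with x hx
      have := (hasDerivWithinAt_iff_tendsto_slope' (by simp)).1 hx
      refine this.congr fun t => ?_
      simp [slope_def_field, div_eq_inv_mul])
  -- The left derivative is minus the right derivative in the direction `-e`, and the two signs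
  -- cancel in the integration by parts.
  have hl := integral_mul_eq_neg_of_tendsto hF hH (v := -e) (D := fun x => -Dl x)
    (by
      filter_upwards [hreg] with x hx t ht ht1
      have := hdom hx (-t) (by rwa [abs_neg, abs_of_pos ht])
      rw [abs_neg, abs_of_pos ht, neg_smul, ← smul_neg] at this
      exact this)
    (by
      filter_upwards [hleft] with x hx
      have h1 := (hasDerivWithinAt_iff_tendsto_slope' (by simp)).1 hx
      have h2 : Tendsto (fun t : ℝ => -t) (𝓝[>] 0) (𝓝[<] 0) := by
        have := tendsto_neg_nhdsGT (a := (0 : ℝ))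
        rwa [neg_zero] at this
      refine ((h1.comp h2).neg).congr fun t => ?_
      simp only [slope_def_field, Function.comp, zero_smul, add_zero, sub_zero, neg_smul, smul_neg]
      rw [div_neg, neg_neg, div_eq_inv_mul])
  have hwr : HasWeakPartial l (strongMaximalReal f) Dr := ⟨hF, hr.1, hr.2⟩
  have hwl : HasWeakPartial l (strongMaximalReal f) Dl := by
    refine ⟨hF, (locallyIntegrable_neg_iff).1 hl.1, fun φ hφ hc => ?_⟩
    have := hl.2 φ hφ hc
    simp only [map_neg, mul_neg, neg_mul, integral_neg, neg_neg] at this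
    rw [← this, neg_neg]
  refine ⟨Dr, hwr, ?_⟩
  -- Uniqueness of weak derivatives forces equality of the one-sided derivatives almost everywhere.
  -- This two-sided differentiability is also what the continuity argument needs.
  filter_upwards [hwr.ae_eq hwl] with x hx
  have h1 : HasDerivWithinAt _ (Dr x) _ _ :=
    hasDerivWithinAt_Ioi_norm_add_smul (productMap f x) (productMapDeriv f g x)
  have h2 : HasDerivWithinAt _ (Dl x) _ _ :=
    hasDerivWithinAt_Iio_norm_add_smul (productMap f x) (productMapDeriv f g x)
  rw [← hx] at h2
  have h3 := h2.Iic_of_Iio.union h1.Ici_of_Ioi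
  rw [Iic_union_Ici] at h3
  exact hasDerivWithinAt_univ.1 h3

/-! ### Sobolev norms and dominated convergence -/

theorem HasWeakPartial.sub {l : Fin d} {f g f' g' : EuclideanSpace ℝ (Fin d) → ℝ}
    (hf : HasWeakPartial l f f') (hg : HasWeakPartial l g g') :
    HasWeakPartial l (f - g) (f' - g') := by
  refine ⟨hf.1.sub hg.1, hf.2.1.sub hg.2.1, fun φ hφ hc => ?_⟩
  obtain ⟨B, r, hB, hr⟩ := exists_bound_of_hasCompactSupport hφ.continuous hc
  have hψ : Continuous fun z => fderiv ℝ φ z (EuclideanSpace.single l 1) :=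
    (hφ.continuous_fderiv (by simp)).clm_apply continuous_const
  obtain ⟨B', r', hB', hr'⟩ := exists_bound_of_hasCompactSupport hψ
    (hc.fderiv_apply (𝕜 := ℝ) _)
  simp_rw [Pi.sub_apply, sub_mul]
  rw [integral_sub (integrable_mul_of_bounded hf.1 hψ.aestronglyMeasurable hB' hr')
      (integrable_mul_of_bounded hg.1 hψ.aestronglyMeasurable hB' hr'),
    integral_sub (integrable_mul_of_bounded hf.2.1 hφ.continuous.aestronglyMeasurable hB hr)
      (integrable_mul_of_bounded hg.2.1 hφ.continuous.aestronglyMeasurable hB hr),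
    hf.2.2 φ hφ hc, hg.2.2 φ hφ hc]
  ring

namespace MemW1

variable {p : ℝ≥0∞} {f g : EuclideanSpace ℝ (Fin d) → ℝ}

theorem hasWeakPartial (h : MemW1 p f) (l : Fin d) : HasWeakPartial l f (weakPartial l f) := by
  obtain ⟨g, hg, -⟩ := h.2 l
  exact hg.weakPartial

theorem memLp_weakPartial (h : MemW1 p f) (l : Fin d) : MemLp (weakPartial l f) p volume := by
  obtain ⟨g, hg, hgp⟩ := h.2 l
  exact hgp.ae_eq (hg.ae_eq hg.weakPartial)

theorem weakPartial_sub (hf : MemW1 p f) (hg : MemW1 p g) (l : Fin d) :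
    weakPartial l (f - g) =ᵐ[volume] weakPartial l f - weakPartial l g := by
  have h := (hf.hasWeakPartial l).sub (hg.hasWeakPartial l)
  exact h.weakPartial.ae_eq h

end MemW1

theorem eLpNorm_weakPartial_le (p : ℝ≥0∞) (f : EuclideanSpace ℝ (Fin d) → ℝ) (l : Fin d) :
    eLpNorm (weakPartial l f) p volume ≤ w1Norm p f := by
  refine le_trans (eLpNorm_mono fun x => ?_) le_add_self
  exact PiLp.norm_apply_le (weakGradient f x) l

theorem eLpNorm_weakGradient_le {p : ℝ≥0∞} (hp : 1 ≤ p) {f : EuclideanSpace ℝ (Fin d) → ℝ}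
    (hf : ∀ l, AEStronglyMeasurable (weakPartial l f)) :
    eLpNorm (weakGradient f) p volume ≤ ∑ l, eLpNorm (weakPartial l f) p volume := by
  have h1 : weakGradient f = ∑ l, fun x => EuclideanSpace.single l (weakPartial l f x) := by
    funext x
    ext k
    simp [weakGradient, Finset.sum_apply]
  have hcont (l : Fin d) : Continuous fun r : ℝ => EuclideanSpace.single l r :=
    (Isometry.of_dist_eq fun a b => PiLp.dist_single_same 2 (fun _ => ℝ) l a b).continuous
  rw [h1]
  refine (eLpNorm_sum_le (fun l _ => (hcont l).comp_aestronglyMeasurable (hf l)) hp).trans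
    (Finset.sum_le_sum fun l _ => eLpNorm_mono fun x => ?_)
  simp

theorem rectMax_enorm_le_add {f g : EuclideanSpace ℝ (Fin d) → ℝ} (hf : AEStronglyMeasurable f)
    (x : EuclideanSpace ℝ (Fin d)) : rectMax (fun y => ‖g y‖ₑ) x ≤
      rectMax (fun y => ‖f y‖ₑ) x + rectMax (fun y => ‖(g - f) y‖ₑ) x := by
  refine iSup_le fun a => iSup_le fun b => iSup_le fun hx => ?_
  calc _ ≤ (volume (openRectangle a b))⁻¹ *
        ∫⁻ y in openRectangle a b, (‖f y‖ₑ + ‖(g - f) y‖ₑ) := by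
        gcongr with y
        calc ‖g y‖ₑ = ‖f y + (g - f) y‖ₑ := by simp
          _ ≤ _ := enorm_add_le _ _
    _ ≤ _ := by
        rw [lintegral_add_left' hf.enorm.restrict, mul_add]
        exact add_le_add (average_le_rectMax _ hx) (average_le_rectMax _ hx)

theorem tendsto_eLpNorm_zero_of_dominated {α : Type*} [MeasurableSpace α] {μ : Measure α}
    {p : ℝ≥0∞} (hp : 1 < p ∧ p < ⊤) {u : ℕ → α → ℝ} {K : α → ℝ≥0∞} {c : ℝ≥0∞} (hc : c ≠ ⊤)
    (hu : ∀ n, AEStronglyMeasurable (u n) μ) (hK : eLpNorm K p μ < ⊤)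
    (hdom : ∀ᵐ x ∂μ, ∀ n, ‖u n x‖ₑ ≤ c * K x)
    (hlim : ∀ᵐ x ∂μ, Tendsto (fun n => u n x) atTop (𝓝 0)) :
    Tendsto (fun n => eLpNorm (u n) p μ) atTop (𝓝 0) := by
  have h1 := one_lt_toReal_of_one_lt hp.1 hp.2
  have h2 : Tendsto (fun n => ∫⁻ x, ‖u n x‖ₑ ^ p.toReal ∂μ) atTop (𝓝 (∫⁻ _, 0 ∂μ)) := by
    refine tendsto_lintegral_of_dominated_convergence' (fun x => c ^ p.toReal * K x ^ p.toReal)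
      (fun n => (hu n).enorm.pow_const _) (fun n => ?_) ?_ ?_
    · filter_upwards [hdom] with x hx
      rw [← ENNReal.mul_rpow_of_nonneg _ _ (by linarith)]
      exact ENNReal.rpow_le_rpow (hx n) (by linarith)
    · have hc' : c ^ p.toReal ≠ ⊤ := ENNReal.rpow_ne_top_of_nonneg (by linarith) hc
      rw [lintegral_const_mul' _ _ hc', ← eLpNorm_rpow_toReal hp.1 hp.2]
      exact ENNReal.mul_ne_top hc' (ENNReal.rpow_ne_top_of_nonneg (by linarith) hK.ne)
    · filter_upwards [hlim] with x hx
      have h3 := (hx.enorm).ennrpow_const p.toReal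
      rwa [enorm_zero, ENNReal.zero_rpow_of_pos (by linarith)] at h3
  rw [lintegral_zero] at h2
  have h3 := h2.ennrpow_const (1 / p.toReal)
  rw [ENNReal.zero_rpow_of_pos (by positivity)] at h3
  refine h3.congr fun n => ?_
  rw [eLpNorm_eq_lintegral_rpow_enorm_toReal (zero_lt_one.trans hp.1).ne' hp.2.ne]

/-! ### The pointwise estimate and boundedness on Sobolev spaces -/

section Boundedness

variable {P : Fin m → ℝ≥0∞} {p : ℝ≥0∞}

theorem ae_forall_isRegularPoint (hP : ∀ i, 1 < P i ∧ P i < ⊤)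
    {f : Fin m → EuclideanSpace ℝ (Fin d) → ℝ} (hf : ∀ i, MemW1 (P i) (f i)) (l : Fin d) :
    ∀ᵐ x, ∀ i, IsRegularPoint l (f i) (weakPartial l (f i)) x :=
  ae_all_iff.2 fun i => ae_isRegularPoint l (hP i).1 (hP i).2 (hf i).1 ((hf i).memLp_weakPartial l)

theorem hasWeakPartial_strongMaximalReal (hP : ∀ i, 1 < P i ∧ P i < ⊤) (hp : 1 < p ∧ p < ⊤)
    (hPp : 1 / p = ∑ i, 1 / P i) {f : Fin m → EuclideanSpace ℝ (Fin d) → ℝ}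
    (hf : ∀ i, MemW1 (P i) (f i)) (l : Fin d) :
    HasWeakPartial l (strongMaximalReal f) (weakPartial l (strongMaximalReal f)) ∧
    ∀ᵐ x, HasDerivAt (fun t : ℝ => ‖productMap f x +
      t • productMapDeriv f (fun i => weakPartial l (f i)) x‖)
      (weakPartial l (strongMaximalReal f) x) 0 := by
  obtain ⟨D, hD, hD'⟩ := exists_hasWeakPartial_strongMaximalReal hP hp hPp
    (fun i => (hf i).hasWeakPartial l) (fun i => (hf i).1) (fun i => (hf i).memLp_weakPartial l)
  refine ⟨hD.weakPartial, ?_⟩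
  filter_upwards [hD', hD.ae_eq hD.weakPartial] with x hx hx'
  rwa [← hx']

theorem enorm_weakPartial_strongMaximalReal_le (hP : ∀ i, 1 < P i ∧ P i < ⊤) (hp : 1 < p ∧ p < ⊤)
    (hPp : 1 / p = ∑ i, 1 / P i) {f : Fin m → EuclideanSpace ℝ (Fin d) → ℝ}
    (hf : ∀ i, MemW1 (P i) (f i)) (l : Fin d) :
    ∀ᵐ x, ‖weakPartial l (strongMaximalReal f) x‖ₑ ≤
      ∑ μ, strongMaximal (Function.update f μ (weakPartial l (f μ))) x := by
  filter_upwards [(hasWeakPartial_strongMaximalReal hP hp hPp hf l).2,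
    ae_forall_isRegularPoint hP hf l] with x hx hreg
  exact hx.enorm_le_of_norm_add_smul.trans (enorm_productMapDeriv_le
    (fun i => ((hf i).hasWeakPartial l).1) (fun i => ((hf i).hasWeakPartial l).2.1)
    (fun i => (hreg i).rectMax_lt_top) (fun i => (hreg i).rectMax_deriv_lt_top))

theorem exists_eLpNorm_weakPartial_strongMaximalReal_le (d : ℕ) (hP : ∀ i, 1 < P i ∧ P i < ⊤)
    (hp : 1 < p ∧ p < ⊤) (hPp : 1 / p = ∑ i, 1 / P i) :
    ∃ C : ℝ≥0, ∀ f : Fin m → EuclideanSpace ℝ (Fin d) → ℝ, (∀ i, MemW1 (P i) (f i)) →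
      eLpNorm (strongMaximal f) p volume ≤ C * ∏ i, w1Norm (P i) (f i) ∧
      ∀ l, eLpNorm (weakPartial l (strongMaximalReal f)) p volume ≤
        m * C * ∏ i, w1Norm (P i) (f i) := by
  obtain ⟨C, hC⟩ := exists_eLpNorm_strongMaximal_le d hP hp hPp
  refine ⟨C, fun f hf => ⟨(hC f fun i => (hf i).1.1).trans ?_, fun l => ?_⟩⟩
  · gcongr with i
    exact le_self_add
  calc eLpNorm (weakPartial l (strongMaximalReal f)) p volume
      ≤ eLpNorm (∑ μ, strongMaximal (Function.update f μ (weakPartial l (f μ)))) p volume := by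
        refine eLpNorm_mono_enorm_ae ?_
        filter_upwards [enorm_weakPartial_strongMaximalReal_le hP hp hPp hf l] with x hx
        simpa using hx
    _ ≤ ∑ μ, eLpNorm (strongMaximal (Function.update f μ (weakPartial l (f μ)))) p volume :=
        eLpNorm_sum_le (fun μ _ => (measurable_strongMaximal _).aestronglyMeasurable) hp.1.le
    _ ≤ ∑ _μ : Fin m, C * ∏ i, w1Norm (P i) (f i) := by
        refine Finset.sum_le_sum fun μ _ => (hC _ fun i => ?_).trans ?_
        · by_cases hi : i = μ
          · subst hi; simpa using ((hf i).memLp_weakPartial l).1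
          · simpa [hi] using (hf i).1.1
        · gcongr with i
          by_cases hi : i = μ
          · subst hi; simpa using eLpNorm_weakPartial_le (P i) (f i) l
          · rw [Function.update_of_ne hi]
            exact le_self_add
    _ = _ := by simp [mul_assoc]

theorem MemW1.w1Norm_lt_top (hp : 1 < p) {f : EuclideanSpace ℝ (Fin d) → ℝ} (hf : MemW1 p f) :
    w1Norm p f < ⊤ :=
  ENNReal.add_lt_top.2 ⟨hf.1.2, (eLpNorm_weakGradient_le hp.le
    fun l => (hf.memLp_weakPartial l).1).trans_lt
      (ENNReal.sum_lt_top.2 fun l _ => (hf.memLp_weakPartial l).2)⟩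

theorem memW1_strongMaximalReal (hP : ∀ i, 1 < P i ∧ P i < ⊤) (hp : 1 < p ∧ p < ⊤)
    (hPp : 1 / p = ∑ i, 1 / P i) {f : Fin m → EuclideanSpace ℝ (Fin d) → ℝ}
    (hf : ∀ i, MemW1 (P i) (f i)) : MemW1 p (strongMaximalReal f) := by
  obtain ⟨C, hC⟩ := exists_eLpNorm_weakPartial_strongMaximalReal_le d hP hp hPp
  refine ⟨memLp_strongMaximalReal hP hp hPp fun i => (hf i).1, fun l => ⟨_,
    (hasWeakPartial_strongMaximalReal hP hp hPp hf l).1,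
    (hasWeakPartial_strongMaximalReal hP hp hPp hf l).1.2.1.aestronglyMeasurable,
    ((hC f hf).2 l).trans_lt ?_⟩⟩
  refine ENNReal.mul_lt_top (ENNReal.mul_lt_top (ENNReal.natCast_lt_top m) ENNReal.coe_lt_top)
    (ENNReal.prod_lt_top fun i _ => (hf i).w1Norm_lt_top (hP i).1)

theorem exists_w1Norm_strongMaximalReal_le (d : ℕ) (hP : ∀ i, 1 < P i ∧ P i < ⊤)
    (hp : 1 < p ∧ p < ⊤) (hPp : 1 / p = ∑ i, 1 / P i) :
    ∃ C : ℝ≥0, ∀ f : Fin m → EuclideanSpace ℝ (Fin d) → ℝ, (∀ i, MemW1 (P i) (f i)) →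
      w1Norm p (strongMaximalReal f) ≤ C * ∏ i, w1Norm (P i) (f i) := by
  obtain ⟨C, hC⟩ := exists_eLpNorm_weakPartial_strongMaximalReal_le d hP hp hPp
  refine ⟨C + d * (m * C), fun f hf => ?_⟩
  have hmem := memW1_strongMaximalReal hP hp hPp hf
  calc w1Norm p (strongMaximalReal f)
      ≤ eLpNorm (strongMaximal f) p volume +
          ∑ l, eLpNorm (weakPartial l (strongMaximalReal f)) p volume :=
        add_le_add (eLpNorm_toReal_le _ _)
          (eLpNorm_weakGradient_le hp.1.le fun l => (hmem.memLp_weakPartial l).1)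
    _ ≤ C * ∏ i, w1Norm (P i) (f i) + ∑ _l : Fin d, m * C * ∏ i, w1Norm (P i) (f i) :=
        add_le_add (hC f hf).1 (Finset.sum_le_sum fun l _ => (hC f hf).2 l)
    _ = _ := by
        rw [Finset.sum_const, Finset.card_univ, Fintype.card_fin, nsmul_eq_mul]
        push_cast
        ring

theorem ae_strongMaximal_lt_top (hP : ∀ i, 1 < P i ∧ P i < ⊤) (hp : 1 < p ∧ p < ⊤)
    (hPp : 1 / p = ∑ i, 1 / P i) {f : Fin m → EuclideanSpace ℝ (Fin d) → ℝ}
    (hf : ∀ i, MemW1 (P i) (f i)) : ∀ᵐ x, strongMaximal f x < ⊤ := by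
  obtain ⟨C, hC⟩ := exists_eLpNorm_strongMaximal_le d hP hp hPp
  exact ae_lt_top_of_eLpNorm_lt_top hp.1 hp.2 (measurable_strongMaximal f)
    ((hC f fun i => (hf i).1.1).trans_lt (ENNReal.mul_lt_top ENNReal.coe_lt_top
      (ENNReal.prod_lt_top fun i _ => (hf i).1.2)))

end Boundedness

/-! ### Continuity along rapidly converging sequences -/

section Continuity

variable {P : Fin m → ℝ≥0∞} {p : ℝ≥0∞} {f : Fin m → EuclideanSpace ℝ (Fin d) → ℝ}
  {G : ℕ → Fin m → EuclideanSpace ℝ (Fin d) → ℝ}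

/-- Along a rapidly converging sequence, the maximal functions converge almost everywhere and have
a majorant in `L^p`. -/
theorem exists_majorant_rectMax {p : ℝ≥0∞} (hp : 1 < p ∧ p < ⊤)
    {f : EuclideanSpace ℝ (Fin d) → ℝ} {g : ℕ → EuclideanSpace ℝ (Fin d) → ℝ}
    (hf : MemLp f p volume) (hg : ∀ n, AEStronglyMeasurable (g n))
    (hfg : ∀ n, eLpNorm (g n - f) p volume ≤ 2⁻¹ ^ n) :
    (∀ᵐ x, Tendsto (fun n => rectMax (fun y => ‖(g n - f) y‖ₑ) x) atTop (𝓝 0)) ∧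
      ∃ K : EuclideanSpace ℝ (Fin d) → ℝ≥0∞, Measurable K ∧ eLpNorm K p volume < ⊤ ∧
        (∀ x, rectMax (fun y => ‖f y‖ₑ) x ≤ K x) ∧
          ∀ n x, rectMax (fun y => ‖g n y‖ₑ) x ≤ K x := by
  obtain ⟨C, hC⟩ := exists_eLpNorm_rectMax_le d hp.1 hp.2
  have h1 (n : ℕ) : eLpNorm (rectMax fun y => ‖(g n - f) y‖ₑ) p volume ≤ C * 2⁻¹ ^ n :=
    (hC _ ((hg n).sub hf.1)).trans (by gcongr; exact hfg n)
  refine ⟨ae_tendsto_zero_of_eLpNorm_le hp.1 hp.2 (fun n => measurable_rectMax _)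
    ENNReal.coe_lt_top h1, fun x => rectMax (fun y => ‖f y‖ₑ) x +
      ⨆ n, rectMax (fun y => ‖(g n - f) y‖ₑ) x,
    (measurable_rectMax _).add (Measurable.iSup fun n => measurable_rectMax _), ?_,
    fun x => le_self_add, fun n x => ?_⟩
  · exact (eLpNorm_add_le (measurable_rectMax _).aestronglyMeasurable
      (Measurable.iSup fun n => measurable_rectMax _).aestronglyMeasurable hp.1.le).trans_lt
      (ENNReal.add_lt_top.2 ⟨hf.eLpNorm_rectMax_lt_top hp.1 hp.2,
        eLpNorm_iSup_lt_top hp.1 hp.2 (fun n => measurable_rectMax _) ENNReal.coe_lt_top h1⟩)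
  · refine (rectMax_enorm_le_add hf.1 x).trans ?_
    exact add_le_add le_rfl <| le_iSup (fun n => rectMax (fun y => ‖(g n - f) y‖ₑ) x) n

theorem tendsto_averageMap (i : Fin m) {f : EuclideanSpace ℝ (Fin d) → ℝ}
    {g : ℕ → EuclideanSpace ℝ (Fin d) → ℝ} (hf : LocallyIntegrable f)
    (hg : ∀ n, LocallyIntegrable (g n)) {x : EuclideanSpace ℝ (Fin d)}
    (hfx : rectMax (fun y => ‖f y‖ₑ) x < ⊤) (hgx : ∀ n, rectMax (fun y => ‖g n y‖ₑ) x < ⊤)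
    (h : Tendsto (fun n => rectMax (fun y => ‖(g n - f) y‖ₑ) x) atTop (𝓝 0)) :
    Tendsto (fun n => (averageMap i (g n) x : KernelTuple d m →ᵇ ℝ)) atTop
      (𝓝 (averageMap i f x)) := by
  rw [tendsto_iff_edist_tendsto_0]
  refine tendsto_of_tendsto_of_tendsto_of_le_of_le tendsto_const_nhds h (fun _ => zero_le)
    fun n => ?_
  simp only [edist_eq_enorm_sub]
  exact enorm_averageMap_sub_le i (hg n) hf (hgx n) hfx

theorem strongMaximal_update_le (f : Fin m → EuclideanSpace ℝ (Fin d) → ℝ) (μ : Fin m)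
    (g : EuclideanSpace ℝ (Fin d) → ℝ) {K K' : Fin m → ℝ≥0∞} {x : EuclideanSpace ℝ (Fin d)}
    (hf : ∀ i, rectMax (fun y => ‖f i y‖ₑ) x ≤ K i) (hg : rectMax (fun y => ‖g y‖ₑ) x ≤ K' μ) :
    strongMaximal (Function.update f μ g) x ≤ ∏ i, (K i + K' i) := by
  refine (strongMaximal_le_prod_rectMax _ x).trans (Finset.prod_le_prod' fun i _ => ?_)
  by_cases hi : i = μ
  · subst hi
    simpa using hg.trans le_add_self
  · simpa [hi] using (hf i).trans le_self_add

theorem tendsto_eLpNorm_strongMaximalReal_sub (hP : ∀ i, 1 < P i ∧ P i < ⊤) (hp : 1 < p ∧ p < ⊤)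
    (hPp : 1 / p = ∑ i, 1 / P i) (hf : ∀ i, MemW1 (P i) (f i)) (hG : ∀ n i, MemW1 (P i) (G n i))
    (hlim : ∀ n i, w1Norm (P i) (G n i - f i) ≤ 2⁻¹ ^ n) :
    Tendsto (fun n => eLpNorm (strongMaximalReal (G n) - strongMaximalReal f) p volume)
      atTop (𝓝 0) := by
  have hmaj (i : Fin m) := exists_majorant_rectMax (hP i) (hf i).1 (fun n => (hG n i).1.1)
    (fun n => le_self_add.trans (hlim n i))
  choose hae K hKm hKp hKf hKG using hmaj
  have hfl (i : Fin m) : LocallyIntegrable (f i) := (hf i).1.locallyIntegrable (hP i).1.le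
  have hGl (n : ℕ) (i : Fin m) : LocallyIntegrable (G n i) :=
    (hG n i).1.locallyIntegrable (hP i).1.le
  have hfin : ∀ᵐ x, ∀ i, K i x < ⊤ := ae_all_iff.2 fun i =>
    ae_lt_top_of_eLpNorm_lt_top (hP i).1 (hP i).2 (hKm i) (hKp i)
  have hprod (g : Fin m → EuclideanSpace ℝ (Fin d) → ℝ) (x : EuclideanSpace ℝ (Fin d))
      (hg : ∀ i, rectMax (fun y => ‖g i y‖ₑ) x ≤ K i x) :
      ‖strongMaximalReal g x‖ₑ ≤ ∏ i, K i x := by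
    rw [strongMaximalReal, Real.enorm_of_nonneg ENNReal.toReal_nonneg]
    exact ENNReal.ofReal_toReal_le.trans ((strongMaximal_le_prod_rectMax g x).trans
      (Finset.prod_le_prod' fun i _ => hg i))
  refine tendsto_eLpNorm_zero_of_dominated hp (K := fun x => ∏ i, K i x) (c := 2) (by simp)
    (fun n => ((measurable_strongMaximal (G n)).ennreal_toReal.sub
      (measurable_strongMaximal f).ennreal_toReal).aestronglyMeasurable)
    ((eLpNorm_prod_le hP hp hPp fun i => (hKm i).aemeasurable).trans_lt
      (ENNReal.prod_lt_top fun i _ => hKp i)) (ae_of_all _ fun x n => ?_) ?_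
  · rw [Pi.sub_apply, two_mul]
    exact enorm_sub_le.trans (add_le_add (hprod _ x fun i => hKG i n x) (hprod _ x fun i => hKf i x))
  · filter_upwards [ae_all_iff.2 hae, hfin] with x hx hxK
    have h1 : Tendsto (fun n => productMap (G n) x) atTop (𝓝 (productMap f x)) :=
      tendsto_finsetProd _ fun i _ => tendsto_averageMap i (hfl i) (fun n => hGl n i)
        ((hKf i x).trans_lt (hxK i)) (fun n => (hKG i n x).trans_lt (hxK i)) (hx i)
    have h2 := (h1.norm).sub_const ‖productMap f x‖
    rw [sub_self] at h2
    refine h2.congr fun n => ?_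
    rw [Pi.sub_apply, strongMaximalReal_eq_norm (hGl n) fun i => (hKG i n x).trans_lt (hxK i),
      strongMaximalReal_eq_norm hfl fun i => (hKf i x).trans_lt (hxK i)]
    rfl

/-- Domination comes from the pointwise estimate and majorants for the functions and their
derivatives. Pointwise convergence cannot come from that estimate, as the maximal operator is not
linear; it comes from convexity of the norm along `a + t b`. -/
theorem tendsto_eLpNorm_weakPartial_strongMaximalReal_sub (hP : ∀ i, 1 < P i ∧ P i < ⊤)
    (hp : 1 < p ∧ p < ⊤) (hPp : 1 / p = ∑ i, 1 / P i) (hf : ∀ i, MemW1 (P i) (f i))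
    (hG : ∀ n i, MemW1 (P i) (G n i)) (hlim : ∀ n i, w1Norm (P i) (G n i - f i) ≤ 2⁻¹ ^ n)
    (l : Fin d) :
    Tendsto (fun n => eLpNorm (weakPartial l (strongMaximalReal (G n)) -
      weakPartial l (strongMaximalReal f)) p volume) atTop (𝓝 0) := by
  have hmaj (i : Fin m) := exists_majorant_rectMax (hP i) (hf i).1 (fun n => (hG n i).1.1)
    (fun n => le_self_add.trans (hlim n i))
  have hmaj' (i : Fin m) := exists_majorant_rectMax (hP i) ((hf i).memLp_weakPartial l)
    (fun n => ((hG n i).memLp_weakPartial l).1) (fun n => by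
      rw [← eLpNorm_congr_ae ((hG n i).weakPartial_sub (hf i) l)]
      exact (eLpNorm_weakPartial_le _ _ l).trans (hlim n i))
  choose hae K hKm hKp hKf hKG using hmaj
  choose hae' K' hKm' hKp' hKf' hKG' using hmaj'
  have hfl (i : Fin m) : LocallyIntegrable (f i) := ((hf i).hasWeakPartial l).1
  have hGl (n : ℕ) (i : Fin m) : LocallyIntegrable (G n i) := ((hG n i).hasWeakPartial l).1
  have hfl' (i : Fin m) : LocallyIntegrable (weakPartial l (f i)) := ((hf i).hasWeakPartial l).2.1
  have hGl' (n : ℕ) (i : Fin m) : LocallyIntegrable (weakPartial l (G n i)) :=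
    ((hG n i).hasWeakPartial l).2.1
  have hfin : ∀ᵐ x, ∀ i, K i x < ⊤ := ae_all_iff.2 fun i =>
    ae_lt_top_of_eLpNorm_lt_top (hP i).1 (hP i).2 (hKm i) (hKp i)
  have hfin' : ∀ᵐ x, ∀ i, K' i x < ⊤ := ae_all_iff.2 fun i =>
    ae_lt_top_of_eLpNorm_lt_top (hP i).1 (hP i).2 (hKm' i) (hKp' i)
  have hW := hasWeakPartial_strongMaximalReal hP hp hPp hf l
  have hWG (n : ℕ) := hasWeakPartial_strongMaximalReal hP hp hPp (hG n) l
  -- One `m` for each of the two derivatives: each is bounded by `m` maximal functions, and each of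
  -- these by the product of the `K i + K' i`.
  refine tendsto_eLpNorm_zero_of_dominated hp (K := fun x => ∏ i, (K i x + K' i x)) (c := m + m)
    (by simp) (fun n => (hWG n).1.2.1.aestronglyMeasurable.sub hW.1.2.1.aestronglyMeasurable)
    ((eLpNorm_prod_le hP hp hPp fun i => ((hKm i).add (hKm' i)).aemeasurable).trans_lt
      (ENNReal.prod_lt_top fun i _ => ?_)) ?_ ?_
  · exact (eLpNorm_add_le (hKm i).aestronglyMeasurable (hKm' i).aestronglyMeasurable
      (hP i).1.le).trans_lt (ENNReal.add_lt_top.2 ⟨hKp i, hKp' i⟩)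
  · filter_upwards [enorm_weakPartial_strongMaximalReal_le hP hp hPp hf l, ae_all_iff.2 fun n =>
      enorm_weakPartial_strongMaximalReal_le hP hp hPp (hG n) l] with x hx hxG n
    rw [Pi.sub_apply, add_mul]
    have hsum (u : Fin m → ℝ≥0∞) (hu : ∀ μ, u μ ≤ ∏ i, (K i x + K' i x)) :
        ∑ μ, u μ ≤ m * ∏ i, (K i x + K' i x) :=
      (Finset.sum_le_sum fun μ _ => hu μ).trans (by simp)
    refine enorm_sub_le.trans (add_le_add ((hxG n).trans (hsum _ fun μ => ?_))
      (hx.trans (hsum _ fun μ => ?_)))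
    · exact strongMaximal_update_le _ μ _ (fun i => hKG i n x) (hKG' μ n x)
    · exact strongMaximal_update_le _ μ _ (fun i => hKf i x) (hKf' μ x)
  · filter_upwards [ae_all_iff.2 hae, ae_all_iff.2 hae', hfin, hfin', hW.2,
      ae_all_iff.2 fun n => (hWG n).2] with x hx hx' hxK hxK' hD hDG
    have h1 (i : Fin m) : Tendsto (fun n => (averageMap i (G n i) x : KernelTuple d m →ᵇ ℝ)) atTop
        (𝓝 (averageMap i (f i) x)) :=
      tendsto_averageMap i (hfl i) (fun n => hGl n i)
        ((hKf i x).trans_lt (hxK i)) (fun n => (hKG i n x).trans_lt (hxK i)) (hx i)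
    have h2 (i : Fin m) : Tendsto (fun n => (averageMap i (weakPartial l (G n i)) x :
        KernelTuple d m →ᵇ ℝ)) atTop (𝓝 (averageMap i (weakPartial l (f i)) x)) :=
      tendsto_averageMap i (hfl' i) (fun n => hGl' n i)
        ((hKf' i x).trans_lt (hxK' i)) (fun n => (hKG' i n x).trans_lt (hxK' i)) (hx' i)
    have h3 : Tendsto (fun n => productMap (G n) x) atTop (𝓝 (productMap f x)) :=
      tendsto_finsetProd _ fun i _ => h1 i
    have h4 : Tendsto (fun n => productMapDeriv (G n) (fun i => weakPartial l (G n i)) x) atTop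
        (𝓝 (productMapDeriv f (fun i => weakPartial l (f i)) x)) :=
      tendsto_finsetSum _ fun μ _ => (tendsto_finsetProd _ fun i _ => h1 i).smul (h2 μ)
    have h5 := (tendsto_deriv_of_convexOn (fun n => convexOn_norm_add_smul _ _) hDG hD
      fun t => (h3.add (h4.const_smul t)).norm).sub_const (weakPartial l (strongMaximalReal f) x)
    rw [sub_self] at h5
    exact h5

theorem tendsto_w1Norm_strongMaximalReal_sub (hP : ∀ i, 1 < P i ∧ P i < ⊤)
    (hp : 1 < p ∧ p < ⊤) (hPp : 1 / p = ∑ i, 1 / P i) (hf : ∀ i, MemW1 (P i) (f i))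
    (hG : ∀ n i, MemW1 (P i) (G n i)) (hlim : ∀ n i, w1Norm (P i) (G n i - f i) ≤ 2⁻¹ ^ n) :
    Tendsto (fun n => w1Norm p (strongMaximalReal (G n) - strongMaximalReal f)) atTop (𝓝 0) := by
  have hF := memW1_strongMaximalReal hP hp hPp hf
  have hFG (n : ℕ) := memW1_strongMaximalReal hP hp hPp (hG n)
  have h1 := (tendsto_eLpNorm_strongMaximalReal_sub hP hp hPp hf hG hlim).add
    (tendsto_finsetSum Finset.univ fun l _ =>
      tendsto_eLpNorm_weakPartial_strongMaximalReal_sub hP hp hPp hf hG hlim l)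
  rw [Finset.sum_const_zero, add_zero] at h1
  refine tendsto_of_tendsto_of_tendsto_of_le_of_le tendsto_const_nhds h1 (fun _ => zero_le)
    fun n => ?_
  refine add_le_add le_rfl ((eLpNorm_weakGradient_le hp.1.le fun l => ?_).trans
    (Finset.sum_le_sum fun l _ => (eLpNorm_congr_ae ((hFG n).weakPartial_sub hF l)).le))
  exact (((hFG n).hasWeakPartial l).sub (hF.hasWeakPartial l)).weakPartial.2.1.aestronglyMeasurable

end Continuity

end StrongMaximalFunction

theorem theorem1p1 {d m : ℕ} (hd : 1 ≤ d) (P : Fin m → ℝ≥0∞) (p : ℝ≥0∞)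
    (hP : ∀ i, 1 < P i ∧ P i < ⊤) (hp : 1 < p ∧ p < ⊤) (hPp : 1 / p = ∑ i, 1 / P i) :
    -- boundedness
    (∃ C : ℝ≥0, ∀ f : Fin m → EuclideanSpace ℝ (Fin d) → ℝ, (∀ i, MemW1 (P i) (f i)) →
      (∀ᵐ x, strongMaximal f x < ⊤) ∧ MemW1 p (strongMaximalReal f) ∧
        w1Norm p (strongMaximalReal f) ≤ C * ∏ i, w1Norm (P i) (f i)) ∧
    -- continuity
    (∀ f : Fin m → EuclideanSpace ℝ (Fin d) → ℝ, (∀ i, MemW1 (P i) (f i)) →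
      ∀ ε : ℝ≥0∞, 0 < ε → ∃ δ : ℝ≥0∞, 0 < δ ∧
        ∀ g : Fin m → EuclideanSpace ℝ (Fin d) → ℝ, (∀ i, MemW1 (P i) (g i)) →
          (∀ i, w1Norm (P i) (g i - f i) < δ) →
            w1Norm p (strongMaximalReal g - strongMaximalReal f) < ε) ∧
    -- pointwise estimate for the weak partial derivatives
    (∃ C : ℝ≥0, ∀ f : Fin m → EuclideanSpace ℝ (Fin d) → ℝ, (∀ i, MemW1 (P i) (f i)) →
      ∀ l : Fin d, ∀ᵐ x, ‖weakPartial l (strongMaximalReal f) x‖ₑ ≤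
        C * ∑ μ, strongMaximal (Function.update f μ (weakPartial l (f μ))) x) := by
  refine ⟨?_, fun f hf ε hε => ?_, 1, fun f hf l => ?_⟩
  · obtain ⟨C, hC⟩ := exists_w1Norm_strongMaximalReal_le d hP hp hPp
    exact ⟨C, fun f hf => ⟨ae_strongMaximal_lt_top hP hp hPp hf,
      memW1_strongMaximalReal hP hp hPp hf, hC f hf⟩⟩
  -- Taking `δ = 2⁻¹ ^ n` in the negation produces a sequence that already converges at the required
  -- rate, so no subsequence has to be extracted.
  · by_contra! hcon
    choose G hG hGlim hGε using fun n : ℕ => hcon (2⁻¹ ^ n) (ENNReal.pow_pos (by simp) n)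
    have h := tendsto_w1Norm_strongMaximalReal_sub hP hp hPp hf hG fun n i => (hGlim n i).le
    obtain ⟨n, hn⟩ := (h.eventually_lt_const hε).exists
    exact (hGε n).not_gt hn
  · simpa using enorm_weakPartial_strongMaximalReal_le hP hp hPp hf l
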